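/- **Theorem ($\ell$-duality).** Let $\Lambda$ be the Leech lattice, let $O(\Lambda)=Co_0$ be its isometry group, and let $\hat\Lambda$ be the central extension $1\to\{\pm1\}\to\hat\Lambda\to\Lambda\to1$ with commutator map $(\alpha,\beta)\mapsto(-1)^{\langle\alpha,\beta\rangle}$; choose elements $e^\alpha\in\hat\Lambda$ above $\alpha\in\Lambda$. For $\tau\in O(\Lambda)$ let $\Lambda^\tau=\{v\in\Lambda:\tau v=v\}$ be the fixed-point lattice and let $(\Lambda^\tau)^*=\{v\in\mathbb R\Lambda^\tau:\langle v,w\rangle\in\mathbb Z\text{ for all }w\in\Lambda^\tau\}$ be its dual. A *standard lift* of $\tau$ is an automorphism $\hat\tau$ of the group $\hat\Lambda$ that induces $\tau$ on $\Lambda$ and satisfies $\hat\tau(e^\alpha)=e^\alpha$ for all $\alpha\in\Lambda^\tau$. Let $\mathcal P_0\subset O(\Lambda)$ be the union of the eleven conjugacy classes $1A$, $2A$, $2C$, $3B$, $4C$, $5B$, $6E$, $6G$, $7B$, $8E$, $10F$, whose frame shapes are, in this order, $$1^{24},\ 1^82^8,\ 2^{12},\ 1^63^6,\ 1^42^24^4,\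 1^45^4,\ 1^22^23^26^2,\ 2^36^3,\ 1^37^3,\ 1^22^14^18^2,\ 2^210^2$$ (an isometry has frame shape $\prod_k k^{a_k}$ if its characteristic polynomial is $\prod_k(X^k-1)^{a_k}$). Let $\tau\in\mathcal P_0$. Then $\tau$ has a standard lift, and for every standard lift $\hat\tau$ of $\tau$, with $\ell=|\hat\tau|$ its order, there is an isometry $$\varphi_\tau:\ \sqrt{\ell}\,(\Lambda^\tau)^*\ \longrightarrow\ \Lambda^\tau$$ of lattices, that is, an isomorphism of abelian groups from $\sqrt{\ell}\,(\Lambda^\tau)^*$ onto $\Lambda^\tau$ that preserves inner products. -/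

import Mathlib

open scoped Pointwise

noncomputable section

namespace LeechDuality

/-! ### The extended binary Golay code -/

/-- The bordered circulant `B`: the index `0` is the border, the indices `1, …, 11` are residues
modulo `11`, and for those `B i j = 1` iff `i - j` is a square modulo `11`. -/
def golayB (i j : Fin 12) : ZMod 2 :=
  if i = 0 ∨ j = 0 then (if i = j then 0 else 1)
  else if ((i : ℕ) + 11 - j) % 11 ∈ [0, 1, 3, 4, 5, 9] then 1 else 0

/-- The extended binary Golay code: the row space of the generator matrix `[I | B]`, that is, the
words `(u, u B)` with `u` in `F_2 ^ 12`. -/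
def golayCode : Submodule (ZMod 2) (Fin 24 → ZMod 2) where
  carrier := {c | ∀ j : Fin 12,
    c (Fin.natAdd 12 j) = ∑ i : Fin 12, c (Fin.castAdd 12 i) * golayB i j}
  zero_mem' := by intro j; simp
  add_mem' := by
    intro a b ha hb j
    simp only [Pi.add_apply, add_mul, Finset.sum_add_distrib]
    rw [ha j, hb j]
  smul_mem' := by
    intro r a ha j
    simp only [Pi.smul_apply, smul_eq_mul, mul_assoc, ← Finset.mul_sum]
    rw [ha j]

/-! ### Basic properties of the Golay code -/

/-- The rows of the generator matrix `[I | B]`. -/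
def golayRow (k : Fin 12) : Fin 24 → ZMod 2 :=
  Fin.addCases (m := 12) (n := 12) (fun i => if i = k then 1 else 0) (fun j => golayB k j)

theorem golayRow_left (k i : Fin 12) :
    golayRow k (Fin.castAdd 12 i) = if i = k then 1 else 0 :=
  Fin.addCases_left (m := 12) (n := 12) i

theorem golayRow_right (k j : Fin 12) : golayRow k (Fin.natAdd 12 j) = golayB k j :=
  Fin.addCases_right (m := 12) (n := 12) j

instance (c : Fin 24 → ZMod 2) : Decidable (c ∈ golayCode) :=
  inferInstanceAs (Decidable (∀ j : Fin 12,
    c (Fin.natAdd 12 j) = ∑ i : Fin 12, c (Fin.castAdd 12 i) * golayB i j))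

theorem sum_split {M : Type*} [AddCommMonoid M] (f : Fin 24 → M) :
    ∑ i, f i = ∑ i : Fin 12, f (Fin.castAdd 12 i) + ∑ j : Fin 12, f (Fin.natAdd 12 j) :=
  Fin.sum_univ_add (a := 12) (b := 12) f

theorem eq_sum_golayRow {c : Fin 24 → ZMod 2} (hc : c ∈ golayCode) :
    c = ∑ k : Fin 12, c (Fin.castAdd 12 k) • golayRow k := by
  funext i
  rw [Finset.sum_apply]
  refine Fin.addCases (m := 12) (n := 12) (fun a => ?_) (fun b => ?_) i
  · simp only [Pi.smul_apply, golayRow_left, smul_eq_mul]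
    simp
  · simp only [Pi.smul_apply, golayRow_right, smul_eq_mul]
    exact hc b

theorem golayB_orth : ∀ i k : Fin 12, ∑ j, golayB i j * golayB k j = if i = k then 1 else 0 := by
  decide +kernel

theorem golayCode_orth {c d : Fin 24 → ZMod 2} (hc : c ∈ golayCode) (hd : d ∈ golayCode) :
    ∑ i, c i * d i = 0 := by
  have h : ∑ j : Fin 12, c (Fin.natAdd 12 j) * d (Fin.natAdd 12 j) =
      ∑ i : Fin 12, c (Fin.castAdd 12 i) * d (Fin.castAdd 12 i) := by
    calc ∑ j : Fin 12, c (Fin.natAdd 12 j) * d (Fin.natAdd 12 j)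
        = ∑ j : Fin 12, ∑ i : Fin 12, ∑ k : Fin 12,
            c (Fin.castAdd 12 i) * d (Fin.castAdd 12 k) * (golayB i j * golayB k j) := by
          refine Finset.sum_congr rfl fun j _ => ?_
          rw [hc j, hd j, Finset.sum_mul_sum]
          refine Finset.sum_congr rfl fun i _ => Finset.sum_congr rfl fun k _ => ?_
          ring
      _ = ∑ i : Fin 12, ∑ k : Fin 12, ∑ j : Fin 12,
            c (Fin.castAdd 12 i) * d (Fin.castAdd 12 k) * (golayB i j * golayB k j) := by
          rw [Finset.sum_comm]
          exact Finset.sum_congr rfl fun i _ => Finset.sum_comm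
      _ = _ := by
          refine Finset.sum_congr rfl fun i _ => ?_
          simp [← Finset.mul_sum, golayB_orth]
  rw [sum_split, h]
  exact CharTwo.add_self_eq_zero _

theorem even_sum_mul {c d : Fin 24 → ℤ} (hc : (fun i => (c i : ZMod 2)) ∈ golayCode)
    (hd : (fun i => (d i : ZMod 2)) ∈ golayCode) : (2 : ℤ) ∣ ∑ i, c i * d i := by
  have h := golayCode_orth hc hd
  refine (ZMod.intCast_zmod_eq_zero_iff_dvd _ 2).mp ?_
  push_cast
  exact h

theorem four_dvd_sum_sq_row : ∀ k : Fin 12, 4 ∣ ∑ i, ((golayRow k i).val : ℤ) ^ 2 := by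
  decide +kernel

/-- The Golay code is doubly even. -/
theorem four_dvd_sum_sq {c : Fin 24 → ℤ} (hc : (fun i => (c i : ZMod 2)) ∈ golayCode) :
    (4 : ℤ) ∣ ∑ i, c i ^ 2 := by
  have hrow : ∀ k, golayRow k ∈ golayCode := by
    intro k j
    simp only [golayRow_left, golayRow_right]
    simp
  have hcast : ∀ k i, (((golayRow k i).val : ℤ) : ZMod 2) = golayRow k i := by
    intro k i; simp
  have step : ∀ s : Finset (Fin 12), ∃ e : Fin 24 → ℤ,
      (fun i => (e i : ZMod 2)) = ∑ k ∈ s, (c (Fin.castAdd 12 k) : ZMod 2) • golayRow k ∧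
      (4 : ℤ) ∣ ∑ i, e i ^ 2 := by
    intro s
    induction s using Finset.induction_on with
    | empty => exact ⟨0, by simp [Pi.zero_def], by simp⟩
    | insert a s ha ih =>
      obtain ⟨e, he, h4⟩ := ih
      refine ⟨fun i => e i + c (Fin.castAdd 12 a) * (golayRow a i).val, ?_, ?_⟩
      · rw [Finset.sum_insert ha, ← he]
        funext i
        simp [add_comm]
      · have heg : (fun i => (e i : ZMod 2)) ∈ golayCode := by
          rw [he]
          exact golayCode.sum_mem fun k _ => golayCode.smul_mem _ (hrow k)
        have hag : (fun i => (((golayRow a i).val : ℤ) : ZMod 2)) ∈ golayCode := by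
          simp only [hcast]; exact hrow a
        obtain ⟨u, hu⟩ := even_sum_mul heg hag
        obtain ⟨v, hv⟩ := h4
        obtain ⟨w, hw⟩ := four_dvd_sum_sq_row a
        have : ∑ i, (e i + c (Fin.castAdd 12 a) * (golayRow a i).val) ^ 2 =
            ∑ i, e i ^ 2 + 2 * c (Fin.castAdd 12 a) * ∑ i, e i * ((golayRow a i).val : ℤ) +
            c (Fin.castAdd 12 a) ^ 2 * ∑ i, ((golayRow a i).val : ℤ) ^ 2 := by
          simp only [Finset.mul_sum, ← Finset.sum_add_distrib]
          exact Finset.sum_congr rfl fun i _ => by ring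
        rw [this, hu, hv, hw]
        exact ⟨v + c (Fin.castAdd 12 a) * u + c (Fin.castAdd 12 a) ^ 2 * w, by ring⟩
  obtain ⟨e, he, h4⟩ := step Finset.univ
  rw [← eq_sum_golayRow hc] at he
  have hd : ∀ i, (4 : ℤ) ∣ c i ^ 2 - e i ^ 2 := by
    intro i
    have h := congrFun he i
    rw [eq_comm, ← sub_eq_zero, ← Int.cast_sub, ZMod.intCast_zmod_eq_zero_iff_dvd _ 2] at h
    obtain ⟨t, ht⟩ := h
    exact ⟨t * (t + e i), by
      have : c i = e i + 2 * t := by push_cast at ht; linarith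
      rw [this]; ring⟩
  have := dvd_add (Finset.dvd_sum fun i (_ : i ∈ Finset.univ) => hd i) h4
  simpa [Finset.sum_sub_distrib] using this

/-! ### The Leech lattice -/

/-- The Euclidean space in which the Leech lattice lives. -/
abbrev Space : Type := EuclideanSpace ℝ (Fin 24)

/-- The vectors `√8 v` for `v` in the Leech lattice, in the standard coordinates: integral vectors
`x` for which there is an integer `m` such that all `x i` are congruent to `m` modulo `2`, the word
`((x i - m) / 2) mod 2` is in the Golay code, and the sum of the `x i` is `4 m` modulo `8`. -/
def leechInt : Submodule ℤ (Fin 24 → ℤ) where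
  carrier := {x | ∃ (m : ℤ) (c : Fin 24 → ℤ), (fun i => (c i : ZMod 2)) ∈ golayCode ∧
    (∀ i, x i = m + 2 * c i) ∧ (8 : ℤ) ∣ (∑ i, x i) - 4 * m}
  zero_mem' := ⟨0, 0, by simpa [Pi.zero_def] using golayCode.zero_mem, by simp, by simp⟩
  add_mem' := by
    rintro x y ⟨m, c, hc, hx, hs⟩ ⟨n, d, hd, hy, ht⟩
    refine ⟨m + n, c + d, ?_, ?_, ?_⟩
    · simpa [Pi.add_def] using golayCode.add_mem hc hd
    · intro i
      simp only [Pi.add_apply, hx i, hy i]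
      ring
    · have h := dvd_add hs ht
      simp only [Pi.add_apply, Finset.sum_add_distrib]
      rwa [show ∑ i, x i + ∑ i, y i - 4 * (m + n) =
        ∑ i, x i - 4 * m + (∑ i, y i - 4 * n) by ring]
  smul_mem' := by
    rintro r x ⟨m, c, hc, hx, hs⟩
    refine ⟨r * m, r • c, ?_, ?_, ?_⟩
    · simpa [Pi.smul_def] using golayCode.smul_mem (r : ZMod 2) hc
    · intro i
      simp only [Pi.smul_apply, smul_eq_mul, hx i]
      ring
    · have h := Dvd.dvd.mul_left hs r
      simp only [Pi.smul_apply, smul_eq_mul, ← Finset.mul_sum]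
      rwa [show r * ∑ i, x i - 4 * (r * m) = r * (∑ i, x i - 4 * m) by ring]

/-- The map `x ↦ x / √8` from `ℤ ^ 24` to Euclidean space. -/
def scaledEmb : (Fin 24 → ℤ) →ₗ[ℤ] Space where
  toFun x := WithLp.toLp 2 (fun i => (x i : ℝ) / √8)
  map_add' x y := by ext i; simp [add_div]
  map_smul' r x := by ext i; simp [mul_div_assoc]

/-- The Leech lattice `Λ`. -/
def leech : Submodule ℤ Space := leechInt.map scaledEmb

/-- `Co_0 = O(Λ)`: as `Λ` spans `Space`, an isometry of `Λ` is the same thing as a linear isometry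
of `Space` that preserves `Λ`. -/
def Co0 : Subgroup (Space ≃ₗᵢ[ℝ] Space) where
  carrier := {g | ∀ v, g v ∈ leech ↔ v ∈ leech}
  one_mem' := fun _ => Iff.rfl
  mul_mem' := fun {a b} ha hb v => (ha (b v)).trans (hb v)
  inv_mem' := fun {a} ha v => by
    have h := ha (a⁻¹ v)
    rwa [show a (a⁻¹ v) = v from a.apply_symm_apply v, Iff.comm] at h

/-- The fixed-point lattice `Λ^τ`. -/
def fixedLattice (τ : Co0) : Submodule ℤ Space where
  carrier := {v | v ∈ leech ∧ (τ : Space ≃ₗᵢ[ℝ] Space) v = v}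
  zero_mem' := ⟨leech.zero_mem, map_zero _⟩
  add_mem' := fun ha hb => ⟨leech.add_mem ha.1 hb.1, by rw [map_add, ha.2, hb.2]⟩
  smul_mem' := fun r v hv => ⟨leech.smul_mem r hv.1, by rw [map_zsmul, hv.2]⟩

/-- The dual lattice `L*`: the vectors of the real span of `L` with integral inner products with
all vectors of `L`. -/
def dualLattice (L : Submodule ℤ Space) : Submodule ℤ Space where
  carrier := {v | v ∈ Submodule.span ℝ (L : Set Space) ∧
    ∀ w ∈ L, ∃ n : ℤ, inner ℝ v w = (n : ℝ)}
  zero_mem' := ⟨Submodule.zero_mem _, fun w _ => ⟨0, by simp⟩⟩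
  add_mem' := by
    rintro a b ⟨ha, ha'⟩ ⟨hb, hb'⟩
    refine ⟨Submodule.add_mem _ ha hb, fun w hw => ?_⟩
    obtain ⟨m, hm⟩ := ha' w hw
    obtain ⟨n, hn⟩ := hb' w hw
    exact ⟨m + n, by rw [inner_add_left, hm, hn]; push_cast; rfl⟩
  smul_mem' := by
    rintro r a ⟨ha, ha'⟩
    refine ⟨zsmul_mem ha r, fun w hw => ?_⟩
    obtain ⟨m, hm⟩ := ha' w hw
    exact ⟨r * m, by rw [← Int.cast_smul_eq_zsmul ℝ, inner_smul_left, hm]; simp⟩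

/-! ### The central extension `Λ̂` and standard lifts -/

theorem scaledEmb_injective : Function.Injective scaledEmb := by
  intro x y h
  funext i
  have h1 : (x i : ℝ) / √8 = (y i : ℝ) / √8 := congrArg (fun v : Space => v i) h
  have h2 : (√8 : ℝ) ≠ 0 := by positivity
  have h3 : (x i : ℝ) = y i := by field_simp at h1; exact h1
  exact_mod_cast h3

/-- The lattice `Λ` and its integral model. -/
def leechEquiv : leechInt ≃ₗ[ℤ] leech :=
  Submodule.equivMapOfInjective scaledEmb scaledEmb_injective leechInt

instance : Module.Free ℤ leech := Module.Free.of_equiv leechEquiv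

instance : Module.Finite ℤ leech := Module.Finite.equiv leechEquiv

/-- The inner product of two vectors of `Λ`, as an integer. -/
def pairing (x y : leech) : ℤ := ⌊(inner ℝ (x : Space) (y : Space) : ℝ)⌋

/-- A `ℤ`-basis of `Λ`. -/
def leechBasis : Module.Basis (Fin (Module.finrank ℤ leech)) ℤ leech := Module.finBasis ℤ leech

/-- The exponent of the 2-cocycle: the `ℤ`-bilinear map on `Λ` whose value at the basis vectors
`(b i, b j)` is `⟨b i, b j⟩` if `j < i` and `0` otherwise. -/
def cocycleExp (x y : leech) : ℤ :=
  ∑ i, ∑ j, if j < i then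
    leechBasis.repr x i * leechBasis.repr y j * pairing (leechBasis i) (leechBasis j) else 0

/-! ### The Leech lattice is integral and even -/

theorem leechInt_dot {x y : Fin 24 → ℤ} (hx : x ∈ leechInt) (hy : y ∈ leechInt) :
    (8 : ℤ) ∣ ∑ i, x i * y i := by
  obtain ⟨m, c, hc, hx, s, hs⟩ := hx
  obtain ⟨n, d, hd, hy, t, ht⟩ := hy
  obtain ⟨u, hu⟩ := even_sum_mul hc hd
  simp only [hx, Finset.sum_add_distrib, ← Finset.mul_sum, Finset.sum_const, Finset.card_univ,
    Fintype.card_fin, nsmul_eq_mul] at hs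
  simp only [hy, Finset.sum_add_distrib, ← Finset.mul_sum, Finset.sum_const, Finset.card_univ,
    Fintype.card_fin, nsmul_eq_mul] at ht
  have : ∑ i, x i * y i = 24 * (m * n) + 2 * m * ∑ i, d i + 2 * n * ∑ i, c i +
      4 * ∑ i, c i * d i := by
    rw [show (24 : ℤ) * (m * n) = ∑ _i : Fin 24, m * n by simp]
    simp only [Finset.mul_sum, ← Finset.sum_add_distrib, hx, hy]
    exact Finset.sum_congr rfl fun i _ => by ring
  refine ⟨m * t + n * s + u - 2 * (m * n), ?_⟩
  push_cast at hs ht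
  rw [this, hu]
  linear_combination m * ht + n * hs

theorem leechInt_dot_self {x : Fin 24 → ℤ} (hx : x ∈ leechInt) : (16 : ℤ) ∣ ∑ i, x i * x i := by
  obtain ⟨m, c, hc, hx, s, hs⟩ := hx
  obtain ⟨u, hu⟩ := four_dvd_sum_sq hc
  simp only [hx, Finset.sum_add_distrib, ← Finset.mul_sum, Finset.sum_const, Finset.card_univ,
    Fintype.card_fin, nsmul_eq_mul] at hs
  have : ∑ i, x i * x i = 24 * m ^ 2 + 4 * m * ∑ i, c i + 4 * ∑ i, c i ^ 2 := by
    rw [show (24 : ℤ) * m ^ 2 = ∑ _i : Fin 24, m ^ 2 by simp]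
    simp only [Finset.mul_sum, ← Finset.sum_add_distrib, hx]
    exact Finset.sum_congr rfl fun i _ => by ring
  refine ⟨m * s - m ^ 2 + u, ?_⟩
  push_cast at hs
  rw [this, hu]
  linear_combination 2 * m * hs

theorem inner_scaledEmb (x y : Fin 24 → ℤ) :
    inner ℝ (scaledEmb x) (scaledEmb y) = ((∑ i, x i * y i : ℤ) : ℝ) / 8 := by
  rw [PiLp.inner_apply, Int.cast_sum, Finset.sum_div]
  refine Finset.sum_congr rfl fun i _ => ?_
  have h8 : (√8 : ℝ) * √8 = 8 := Real.mul_self_sqrt (by norm_num)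
  change (y i : ℝ) / √8 * (starRingEnd ℝ) ((x i : ℝ) / √8) = _
  rw [conj_trivial, div_mul_div_comm, h8]
  push_cast
  ring

theorem pairing_cast (x y : leech) : (pairing x y : ℝ) = inner ℝ (x : Space) (y : Space) := by
  obtain ⟨_, a, ha, rfl⟩ := x
  obtain ⟨_, b, hb, rfl⟩ := y
  obtain ⟨k, hk⟩ := leechInt_dot ha hb
  have h : inner ℝ (scaledEmb a) (scaledEmb b) = (k : ℝ) := by
    rw [inner_scaledEmb, hk]; push_cast; ring
  simp only [pairing]
  rw [h, Int.floor_intCast]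

theorem two_dvd_pairing_self (x : leech) : 2 ∣ pairing x x := by
  have h1 := pairing_cast x x
  obtain ⟨_, a, ha, rfl⟩ := x
  obtain ⟨k, hk⟩ := leechInt_dot_self ha
  refine ⟨k, ?_⟩
  rw [inner_scaledEmb, hk] at h1
  have h2 : (pairing ⟨scaledEmb a, ⟨a, ha, rfl⟩⟩ ⟨scaledEmb a, ⟨a, ha, rfl⟩⟩ : ℝ)
      = ((2 * k : ℤ) : ℝ) := by
    rw [h1]; push_cast; ring
  exact_mod_cast h2

theorem pairing_comm (x y : leech) : pairing x y = pairing y x := by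
  simp only [pairing, real_inner_comm]

theorem pairing_eq_sum (x y : leech) : pairing x y =
    ∑ i, ∑ j, leechBasis.repr x i * leechBasis.repr y j *
      pairing (leechBasis i) (leechBasis j) := by
  have key : ∀ z : leech, (z : Space) =
      ∑ i, (leechBasis.repr z i : ℝ) • (leechBasis i : Space) := by
    intro z
    conv_lhs => rw [← leechBasis.sum_repr z]
    rw [Submodule.coe_sum]
    refine Finset.sum_congr rfl fun i _ => ?_
    rw [Submodule.coe_smul, Int.cast_smul_eq_zsmul]
  have h : (pairing x y : ℝ) = ((∑ i, ∑ j, leechBasis.repr x i * leechBasis.repr y j *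
      pairing (leechBasis i) (leechBasis j) : ℤ) : ℝ) := by
    rw [pairing_cast, key x, key y, sum_inner]
    push_cast
    refine Finset.sum_congr rfl fun i _ => ?_
    rw [inner_sum]
    refine Finset.sum_congr rfl fun j _ => ?_
    rw [inner_smul_left, inner_smul_right, pairing_cast, conj_trivial]
    ring
  exact_mod_cast h

theorem cocycleExp_comm (x y : leech) : 2 ∣ cocycleExp x y + cocycleExp y x - pairing x y := by
  have hswap : cocycleExp y x = ∑ i, ∑ j, if i < j then
      leechBasis.repr x i * leechBasis.repr y j * pairing (leechBasis i) (leechBasis j)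
      else 0 := by
    rw [cocycleExp, Finset.sum_comm]
    refine Finset.sum_congr rfl fun i _ => Finset.sum_congr rfl fun j _ => ?_
    split_ifs
    · rw [pairing_comm]; ring
    · rfl
  rw [hswap, pairing_eq_sum, cocycleExp, ← Finset.sum_add_distrib, ← Finset.sum_sub_distrib]
  refine Finset.dvd_sum fun i _ => ?_
  rw [← Finset.sum_add_distrib, ← Finset.sum_sub_distrib]
  refine Finset.dvd_sum fun j _ => ?_
  rcases lt_trichotomy i j with h | h | h
  · simp [h, h.not_gt]
  · subst h
    simpa using (two_dvd_pairing_self (leechBasis i)).mul_left _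
  · simp [h, h.not_gt]

theorem cocycleExp_add_left (x y z : leech) :
    cocycleExp (x + y) z = cocycleExp x z + cocycleExp y z := by
  simp only [cocycleExp, ← Finset.sum_add_distrib]
  refine Finset.sum_congr rfl fun i _ => Finset.sum_congr rfl fun j _ => ?_
  split_ifs
  · simp only [map_add, Finsupp.add_apply]; ring
  · simp

theorem cocycleExp_add_right (x y z : leech) :
    cocycleExp x (y + z) = cocycleExp x y + cocycleExp x z := by
  simp only [cocycleExp, ← Finset.sum_add_distrib]
  refine Finset.sum_congr rfl fun i _ => Finset.sum_congr rfl fun j _ => ?_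
  split_ifs
  · simp only [map_add, Finsupp.add_apply]; ring
  · simp

/-- The 2-cocycle `ε : Λ × Λ → {±1}`. -/
def cocycle (x y : leech) : ℤˣ := (-1) ^ cocycleExp x y

theorem cocycle_add_left (x y z : leech) : cocycle (x + y) z = cocycle x z * cocycle y z := by
  rw [cocycle, cocycleExp_add_left, zpow_add]; rfl

theorem cocycle_add_right (x y z : leech) : cocycle x (y + z) = cocycle x y * cocycle x z := by
  rw [cocycle, cocycleExp_add_right, zpow_add]; rfl

theorem cocycle_zero_left (x : leech) : cocycle 0 x = 1 := by simp [cocycle, cocycleExp]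

theorem cocycle_zero_right (x : leech) : cocycle x 0 = 1 := by simp [cocycle, cocycleExp]

theorem cocycle_neg_left (x y : leech) : cocycle (-x) y = (cocycle x y)⁻¹ := by
  rw [eq_inv_iff_mul_eq_one, ← cocycle_add_left, neg_add_cancel, cocycle_zero_left]

/-- The central extension `1 → {±1} → Λ̂ → Λ → 1` with commutator map `(-1) ^ ⟨α, β⟩`. The element
`⟨s, α⟩` is `s e^α`, and `e^α e^β = ε(α, β) e^(α + β)`. -/
@[ext]
structure LeechHat where
  sign : ℤˣ
  vec : leech

instance : Mul LeechHat := ⟨fun a b => ⟨a.sign * b.sign * cocycle a.vec b.vec, a.vec + b.vec⟩⟩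

instance : One LeechHat := ⟨⟨1, 0⟩⟩

instance : Inv LeechHat := ⟨fun a => ⟨a.sign⁻¹ * cocycle a.vec a.vec, -a.vec⟩⟩

theorem LeechHat.mul_def (a b : LeechHat) :
    a * b = ⟨a.sign * b.sign * cocycle a.vec b.vec, a.vec + b.vec⟩ := rfl

theorem LeechHat.one_def : (1 : LeechHat) = ⟨1, 0⟩ := rfl

theorem LeechHat.inv_def (a : LeechHat) :
    a⁻¹ = ⟨a.sign⁻¹ * cocycle a.vec a.vec, -a.vec⟩ := rfl

instance : Group LeechHat :=
  Group.ofLeftAxioms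
    (by
      intro a b c
      simp only [LeechHat.mul_def, cocycle_add_left, cocycle_add_right, add_assoc]
      congr 1
      ac_rfl)
    (by intro a; ext <;> simp [LeechHat.mul_def, LeechHat.one_def, cocycle_zero_left])
    (by
      intro a
      simp only [LeechHat.mul_def, LeechHat.one_def, LeechHat.inv_def, cocycle_neg_left]
      congr 1
      · rw [mul_right_comm a.sign⁻¹, inv_mul_cancel, one_mul, mul_inv_cancel]
      · exact neg_add_cancel _)

/-- The commutator relation of `Λ̂`. -/
theorem LeechHat.commutator (a b : LeechHat) :
    a * b = ⟨(-1) ^ pairing a.vec b.vec, 0⟩ * (b * a) := by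
  obtain ⟨k, hk⟩ := cocycleExp_comm a.vec b.vec
  have h : pairing a.vec b.vec =
      cocycleExp a.vec b.vec + cocycleExp b.vec a.vec - 2 * k := by omega
  have h2 : ∀ n : ℤ, ((-1 : ℤˣ) ^ n) * (-1) ^ n = 1 := fun n => by
    rw [← mul_zpow]; simp
  ext1
  · simp only [LeechHat.mul_def, cocycle_zero_left, mul_one]
    rw [h, zpow_sub, zpow_add, zpow_mul, show ((-1 : ℤˣ) ^ (2 : ℤ)) = 1 by decide, one_zpow,
      inv_one, mul_one]
    change _ = cocycle a.vec b.vec * cocycle b.vec a.vec * (b.sign * a.sign * cocycle b.vec a.vec)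
    have h3 : cocycle b.vec a.vec * cocycle b.vec a.vec = 1 := h2 _
    calc a.sign * b.sign * cocycle a.vec b.vec
        = (b.sign * a.sign * cocycle a.vec b.vec) *
          (cocycle b.vec a.vec * cocycle b.vec a.vec) := by
          rw [h3, mul_one, mul_comm a.sign]
      _ = _ := by ac_rfl
  · simp only [LeechHat.mul_def]
    rw [zero_add, add_comm]

/-- `g` is a standard lift of `τ`: an automorphism of `Λ̂` that induces `τ` on `Λ` and fixes every
`e^α` with `α` in `Λ^τ` (hence every element of `Λ̂` above `Λ^τ`). Its order is `orderOf g`. -/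
def IsStandardLift (τ : Co0) (g : MulAut LeechHat) : Prop :=
  (∀ a : LeechHat, ((g a).vec : Space) = (τ : Space ≃ₗᵢ[ℝ] Space) (a.vec : Space)) ∧
    ∀ α : leech, (α : Space) ∈ fixedLattice τ → g ⟨1, α⟩ = ⟨1, α⟩

/-! ### The conjugacy classes -/

/-- The isometry of `Space` permuting the coordinates: the standard basis vector with index `i` is
sent to the one with index `π i`. -/
def permIso (π : Equiv.Perm (Fin 24)) : Space ≃ₗᵢ[ℝ] Space :=
  LinearIsometryEquiv.piLpCongrLeft 2 ℝ ℝ π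

theorem permIso_apply (π : Equiv.Perm (Fin 24)) (v : Space) (i : Fin 24) :
    permIso π v i = v (π.symm i) := rfl

/-- The isometry of `Space` changing the signs of the coordinates with index in `D`. -/
def signIso (D : Finset (Fin 24)) : Space ≃ₗᵢ[ℝ] Space where
  toFun v := WithLp.toLp 2 (fun i => if i ∈ D then -v i else v i)
  invFun v := WithLp.toLp 2 (fun i => if i ∈ D then -v i else v i)
  map_add' v w := by
    ext i
    by_cases h : i ∈ D <;> simp [h, add_comm]
  map_smul' r v := by
    ext i
    by_cases h : i ∈ D <;> simp [h]
  left_inv v := by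
    ext i
    by_cases h : i ∈ D <;> simp [h]
  right_inv v := by
    ext i
    by_cases h : i ∈ D <;> simp [h]
  norm_map' v := by
    rw [EuclideanSpace.norm_eq, EuclideanSpace.norm_eq]
    congr 1
    refine Finset.sum_congr rfl fun i _ => ?_
    by_cases h : i ∈ D <;> simp [h]

theorem signIso_apply (D : Finset (Fin 24)) (v : Space) (i : Fin 24) :
    signIso D v i = if i ∈ D then -v i else v i := rfl

theorem permIso_mem_leech {π : Equiv.Perm (Fin 24)}
    (h : ∀ k : Fin 12, (fun i => golayRow k (π.symm i)) ∈ golayCode) {v : Space}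
    (hv : v ∈ leech) : permIso π v ∈ leech := by
  have hπ : ∀ c ∈ golayCode, (fun i => c (π.symm i)) ∈ golayCode := by
    intro c hc
    have h1 : (fun i => c (π.symm i)) =
        ∑ k : Fin 12, c (Fin.castAdd 12 k) • (fun i => golayRow k (π.symm i)) := by
      funext i
      conv_lhs => rw [eq_sum_golayRow hc]
      simp [Finset.sum_apply]
    rw [h1]
    exact golayCode.sum_mem fun k _ => golayCode.smul_mem _ (h k)
  obtain ⟨x, ⟨m, c, hc, hx, hs⟩, rfl⟩ := hv
  refine ⟨fun i => x (π.symm i), ⟨m, fun i => c (π.symm i), hπ _ hc, fun i => hx _, ?_⟩, ?_⟩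
  · rwa [Equiv.sum_comp π.symm x]
  · ext i; rfl

theorem permIso_mem_Co0 {π : Equiv.Perm (Fin 24)}
    (h : ∀ k : Fin 12, (fun i => golayRow k (π.symm i)) ∈ golayCode)
    (h' : ∀ k : Fin 12, (fun i => golayRow k (π i)) ∈ golayCode) : permIso π ∈ Co0 := by
  intro v
  refine ⟨fun hv => ?_, permIso_mem_leech h⟩
  have h1 := permIso_mem_leech (π := π.symm) (by simpa using h') hv
  have h2 : permIso π.symm (permIso π v) = v := by
    ext i; simp [permIso_apply]
  rwa [h2] at h1

theorem signIso_mem_leech {D : Finset (Fin 24)}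
    (hD : (fun i => if i ∈ D then (1 : ZMod 2) else 0) ∈ golayCode) {v : Space}
    (hv : v ∈ leech) : signIso D v ∈ leech := by
  obtain ⟨x, ⟨m, c, hc, hx, hs⟩, rfl⟩ := hv
  have hD' : (fun i => (((if i ∈ D then 1 else 0 : ℤ)) : ZMod 2)) ∈ golayCode := by
    simpa using hD
  refine ⟨fun i => if i ∈ D then -x i else x i,
    ⟨m, fun i => c i - (if i ∈ D then 1 else 0) * (2 * c i + m), ?_, ?_, ?_⟩, ?_⟩
  · have := golayCode.add_mem hc (golayCode.smul_mem (m : ZMod 2) hD)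
    convert this using 1
    funext i
    have h2 : (2 : ZMod 2) = 0 := by decide
    by_cases h : i ∈ D <;> simp [h, h2, CharTwo.sub_eq_add]
  · intro i
    by_cases h : i ∈ D
    · simp only [h, if_true, hx i]; ring
    · simp only [h, if_false, hx i]; ring
  · obtain ⟨u, hu⟩ := even_sum_mul hc hD'
    obtain ⟨w, hw⟩ := four_dvd_sum_sq hD'
    obtain ⟨s, hs⟩ := hs
    have h1 : ∑ i, (if i ∈ D then -x i else x i) = ∑ i, x i -
        4 * (∑ i, c i * (if i ∈ D then 1 else 0)) -
        2 * m * ∑ i, (if i ∈ D then 1 else 0 : ℤ) ^ 2 := by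
      simp only [Finset.mul_sum, ← Finset.sum_sub_distrib]
      refine Finset.sum_congr rfl fun i _ => ?_
      by_cases h : i ∈ D
      · simp only [h, if_true, hx i]; ring
      · simp [h]
    rw [h1, hu, hw]
    exact ⟨s - u - m * w, by linear_combination hs⟩
  · ext i
    rw [signIso_apply]
    change ((if i ∈ D then -x i else x i : ℤ) : ℝ) / √8 =
      if i ∈ D then -((x i : ℝ) / √8) else (x i : ℝ) / √8
    split_ifs
    · push_cast; ring
    · rfl

theorem signIso_mem_Co0 {D : Finset (Fin 24)}
    (hD : (fun i => if i ∈ D then (1 : ZMod 2) else 0) ∈ golayCode) : signIso D ∈ Co0 := by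
  intro v
  refine ⟨fun hv => ?_, signIso_mem_leech hD⟩
  have h1 := signIso_mem_leech hD hv
  rwa [show signIso D (signIso D v) = v from (signIso D).left_inv v] at h1

/-- The names of the eleven conjugacy classes of `Co_0`. -/
inductive ClassName : Type
  | c1A | c2A | c2C | c3B | c4C | c5B | c6E | c6G | c7B | c8E | c10F

/-- The permutation part of a representative, as a product of disjoint cycles. -/
def ClassName.perm : ClassName → Equiv.Perm (Fin 24)
  | c1A => 1
  | c2A => c[1, 11] * c[2, 21] * c[3, 18] * c[4, 6] * c[8, 10] * c[9, 15] * c[12, 13] * c[17, 23]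
  | c2C => c[0, 23] * c[1, 13] * c[2, 17] * c[3, 5] * c[4, 12] * c[6, 11] * c[7, 21] * c[8, 22] *
      c[9, 15] * c[10, 18] * c[14, 16] * c[19, 20]
  | c3B => c[0, 2, 8] * c[1, 18, 5] * c[4, 20, 13] * c[6, 10, 7] * c[11, 19, 16] * c[17, 21, 22]
  | c4C => c[5, 20] * c[19, 22] * c[1, 13, 11, 12] * c[2, 18, 21, 3] * c[4, 15, 6, 9] *
      c[8, 17, 10, 23]
  | c5B => c[0, 22, 20, 11, 16] * c[1, 17, 7, 5, 10] * c[2, 21, 3, 18, 13] * c[6, 14, 23, 8, 19]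
  | c6E => c[3, 9] * c[12, 15] * c[6, 7, 10] * c[11, 16, 19] * c[0, 4, 2, 20, 8, 13] *
      c[1, 22, 18, 17, 5, 21]
  | c6G => c[0, 2, 8] * c[1, 18, 5] * c[4, 20, 13] * c[6, 10, 7] * c[11, 19, 16] * c[17, 21, 22]
  | c7B => c[0, 8, 22, 11, 2, 10, 3] * c[1, 5, 16, 18, 13, 21, 6] * c[7, 17, 19, 14, 15, 20, 23]
  | c8E => c[7, 16] * c[5, 19, 20, 22] * c[1, 21, 13, 3, 11, 2, 12, 18] *
      c[4, 10, 15, 23, 6, 8, 9, 17]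
  | c10F => c[4, 12] * c[9, 15] * c[0, 6, 22, 14, 20, 23, 11, 8, 16, 19] *
      c[1, 3, 17, 18, 7, 13, 5, 2, 10, 21]

/-- The set of coordinates whose sign is changed by a representative. It is non-empty only for `6G`,
where it consists of three of the six fixed points and three of the six 3-cycles. -/
def ClassName.signs : ClassName → Finset (Fin 24)
  | c6G => {1, 4, 5, 12, 13, 14, 17, 18, 20, 21, 22, 23}
  | _ => ∅

theorem ClassName.perm_mem (n : ClassName) : permIso n.perm ∈ Co0 := by
  apply permIso_mem_Co0
  · cases n <;> decide +kernel
  · cases n <;> decide +kernel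

theorem ClassName.signs_mem (n : ClassName) : signIso n.signs ∈ Co0 := by
  apply signIso_mem_Co0
  cases n <;> decide +kernel

/-- A representative of each of the conjugacy classes, a (signed) permutation of the coordinates.
The frame shapes of the representatives are
`1A : 1^24`, `2A : 1^8 2^8`, `2C : 2^12`, `3B : 1^6 3^6`, `4C : 1^4 2^2 4^4`, `5B : 1^4 5^4`,
`6E : 1^2 2^2 3^2 6^2`, `6G : 2^3 6^3`, `7B : 1^3 7^3`, `8E : 1^2 2 4 8^2`, `10F : 2^2 10^2`,
where the shape `∏ k^(a k)` means that the characteristic polynomial is `∏ (X^k - 1)^(a k)`. In all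
cases except `6G` this is the cycle shape of the permutation; for `6G` a 3-cycle with three sign
changes contributes `X^3 + 1` and a fixed point with a sign change contributes `X + 1`, which gives
`(X - 1)^3 (X + 1)^3 (X^3 - 1)^3 (X^3 + 1)^3 = (X^2 - 1)^3 (X^6 - 1)^3`. -/
def ClassName.rep (n : ClassName) : Co0 :=
  ⟨permIso n.perm * signIso n.signs, mul_mem n.perm_mem n.signs_mem⟩

/-- The set `P_0`, the union of the eleven conjugacy classes of `Co_0`. -/
def P0 : Set Co0 := {τ | ∃ n : ClassName, IsConj n.rep τ}

end LeechDuality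

namespace LeechDuality

open scoped InnerProductSpace

/-! ### Bases of the fixed-point lattices -/

/-! Every ingredient is compatible with conjugation in `Co0`, so it suffices to treat the eleven
representatives `n.rep`. Write `T` for the sum of the powers `τ^k` with `0 ≤ k < N`, where `N` is
the order of `τ`; then `T / N` is the orthogonal projection onto the fixed space.

Existence of a lift: a lift amounts to a function on `Λ` modulo `2` whose coboundary is the
difference of the cocycle and its `τ`-translate. This difference is symmetric modulo `2`, because
`τ` preserves the commutator form, and symmetric bilinear forms modulo `2` are coboundaries. On
`Λ^τ` the difference vanishes, so the solution is additive there; as `Λ^τ` is a direct summand,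
composing with a projection gives a correction that makes the solution zero on `Λ^τ`
(`exists_lift_exponent`).

Order of a lift: the `N`-th power of a standard lift multiplies `e^α` by `(-1)^⟨α, Tα⟩`
(`IsStandardLift.pow_apply`). Hence the order is `N` or `2N`, whichever lift is chosen. As `T` is
self-adjoint, the exponent is additive in `α` modulo `2`, so its parity has to be computed only on
generators of `Λ`.

The isometry: vectors of `Λ` project into the dual of `Λ^τ`. The tables list vectors `b i` of `Λ^τ`,
vectors of `Λ` whose projections `d i` are dual to the `b i`, and vectors `c i` of `Λ^τ` with `⟨c i,
c j⟩ = ℓ ⟨d i, d j⟩`. The operator identity `T v = ∑ i, ⟨N • d i, v⟩ • b i` shows that the `b i`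
generate `Λ^τ`, since the coefficients `⟨d i, v⟩` of a vector `v` of `Λ^τ` are integers. The `b i`
are integral combinations of the `c i`, so the `c i` generate as well, and `√ℓ • d i ↦ c i` defines
the isometry (`SimilarityData.exists_isometry`). What is left for each class is a finite list of
integer identities. -/

/-- The rank of the fixed-point lattice. -/
def ClassName.rank : ClassName → ℕ
  | c1A => 24 | c2A => 16 | c2C => 12 | c3B => 12 | c4C => 10 | c5B => 8
  | c6E => 8 | c6G => 6 | c7B => 6 | c8E => 6 | c10F => 4

/-- The order of the representative. -/
def ClassName.period : ClassName → ℕ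
  | c1A => 1 | c2A => 2 | c2C => 2 | c3B => 3 | c4C => 4 | c5B => 5
  | c6E => 6 | c6G => 6 | c7B => 7 | c8E => 8 | c10F => 10

/-- The order of the standard lifts. -/
def ClassName.level : ClassName → ℕ
  | c1A => 1 | c2A => 2 | c2C => 4 | c3B => 3 | c4C => 4 | c5B => 5
  | c6E => 6 | c6G => 12 | c7B => 7 | c8E => 8 | c10F => 20

/-- The table of the inverse of `n.perm`. -/
def ClassName.sourceTable : ClassName → List ℕ
  | c1A => List.range 24
  | c2A =>
    [0, 11, 21, 18, 6, 5, 4, 7, 10, 15, 8, 1, 13, 12, 14, 9, 16, 23, 3, 19, 20, 2, 22, 17]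
  | c2C =>
    [23, 13, 17, 5, 12, 3, 11, 21, 22, 15, 18, 6, 4, 1, 16, 9, 14, 2, 10, 20, 19, 7, 8, 0]
  | c3B | c6G =>
    [8, 5, 0, 3, 13, 18, 7, 10, 2, 9, 6, 16, 12, 20, 14, 15, 19, 22, 1, 11, 4, 17, 21, 23]
  | c4C =>
    [0, 12, 3, 21, 9, 20, 15, 7, 23, 6, 17, 13, 11, 1, 14, 4, 16, 8, 2, 22, 5, 18, 19, 10]
  | c5B =>
    [16, 10, 13, 21, 4, 7, 19, 17, 23, 9, 5, 20, 12, 18, 6, 15, 11, 1, 3, 8, 22, 2, 0, 14]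
  | c6E =>
    [13, 21, 4, 9, 0, 17, 10, 6, 20, 3, 7, 19, 15, 8, 14, 12, 11, 18, 22, 16, 2, 5, 1, 23]
  | c7B =>
    [3, 6, 11, 10, 4, 1, 21, 23, 0, 9, 2, 22, 12, 18, 19, 14, 5, 7, 16, 17, 15, 13, 8, 20]
  | c8E =>
    [0, 18, 11, 13, 17, 22, 23, 16, 6, 8, 4, 3, 2, 21, 14, 10, 7, 9, 12, 5, 19, 1, 20, 15]
  | c10F =>
    [19, 21, 5, 1, 12, 13, 0, 18, 11, 15, 2, 23, 4, 7, 22, 9, 8, 3, 17, 16, 14, 10, 6, 20]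

/-- The vectors `basisVec`, in the encoding of `digit`. -/
def ClassName.basisRows : ClassName → List ℕ
  | c1A =>
    [553533533335313355553553, 664444442424442464442464, 355555355553553135353355,
     224446444464224664444444, 555333555333353353135553, 573353333335533335533553,
     646424424444446424644424, 444264464464444244244624, 335535533535335575533355,
     444444244644666224444244, 575535333333533533533353, 446264644444426244444424,
     464444424444626424642444, 353353555353333155335553, 464444444424244246642464,
     353353355553551335335353, 333333535375533535335533, 644444244444664642424424,
     424444644444242446264644, 353353355553555331335353, 333535335555755533535335,
     553535333535357553533355, 464444444244424262224444, 557535333333335353553333]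
  | c2A =>
    [355313353733353513333533, 333133333555533333533355, 444422464244244444642424,
     424624464244444464644442, 353513353533333353533335, 226246264644644444446664,
     444442464644464624442442, 533133555355555555553353, 553355533155333335355335,
     466644464622444444444644, 446644444644464644244642, 553353535155555535353355,
     533533515355555555553353, 553353535555555535353351, 446646464444444464646644,
     442242424444444464642244]
  | c2C =>
    [224446462624462244444422, 266444444444444664646442, 262444444444444624646442,
     644446244446664446262246, 464226226246466644666244, 464444624244444644646644,
     246444664644444464444642, 444226444424264442444424, 424662444444424244242444,
     444444446462246442424464, 642662444444424424444446, 642444444424644426444426]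
  | c3B =>
    [533353353533557355333333, 533353353533553355337333, 133535335355353555555555,
     666444646642444444442444, 644244444626446444422444, 555333535531333333335333,
     444444442646466466442444, 244644444266442444462444, 755533535353335333353333,
     644444442244442244446242, 644464462442642444442444, 555353555333533533331535]
  | c4C =>
    [555555515555555555555555, 553553533355553573533353, 444444404444444444444448,
     553353533533353533333331, 535535535533355535555531, 446646424444444424646644,
     444444484444444484444444, 424624424644444424644446, 664464644244464644444442,
     424224424644444424244446]
  | c5B =>
    [555555555555555555515555, 644464442642444646464444, 444444444440444444404444,
     444444440440444444444444, 535355333553331535355533, 533353331535333535353333,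
     424244424446242444464442, 535355333557335535355533]
  | c6E =>
    [533553355155553555353535, 533553353753535533355535, 733533333553355555355535,
     133353355335535333335333, 733533335355333533353535, 444244442422444244424242,
     755335535535353355533353, 133553355555553555353535]
  | c6G =>
    [444424426444222622442646, 444424422444262266446242, 444464462444662666446646,
     444444448444444444440444, 444444448444448444444444, 444444444444448444440444]
  | c7B =>
    [444444444440444444484444, 644664646644446464444444, 533553535537335353333333,
     444444444448444444484444, 335335353351333335533353, 444444444448448444444444]
  | c8E =>
    [353553353133333353533335, 535335535355555535355557, 533333555133355555353335,
     424224424644444424244446, 464664424244444424644442, 444444444844444444444448]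
  | c10F =>
    [664664462644642646444446, 442442244422424424222224, 444444448444448444444444,
     444444444440444444404444]

/-- The vectors `dualVec`, in the encoding of `digit`. -/
def ClassName.dualRows : ClassName → List ℕ
  | c1A =>
    [644644466646424444444442, 533135533353553353553355, 646664446466444444444464,
     624246246444424444444464, 555335357535535555355553, 446464224446444444446664,
     535333333553333333535557, 264424462644444444444624, 246642442644444444424644,
     513335353333535335333353, 444646662444444424424442, 644466646446444444444242,
     353333335531535555353535, 533555533351555355535553, 333335555335353333531333,
     373333335733333555355315, 444444644266464444442242, 624664446444444444422442,
     333555513533353333333533, 335553533555353331533553, 353337535535553353555533,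
     573555535555355555355333, 333333333333333333333337, 264444424444464464464422]
  | c2A =>
    [353335533351555533535533, 444444642446644242442644, 444442246464224444464644,
     442444442242444442444662, 353533355537553355355335, 246444244462444446464244,
     331555553535553535553535, 533335753553535555333535, 244442642444442446466444,
     444442642424624444464644, 444444442464464264242644, 264444444262464442444464,
     333535533553555335573535, 264446444446426444442442, 466444444446464442646244,
     355353333315553553555333]
  | c2C =>
    [535557535553333335555333, 444646444444424664424224, 353353533533555533551353,
     555375355333553533353553, 555355355355535133555533, 553557535335533353335553,
     444442666446464444246444, 575353333535355333333533, 355555335333335335551533,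
     553555535531555353553353, 664464464444244244664444, 244444446422444446642446]
  | c3B =>
    [335553355353355335513353, 553335355555533355155535, 513333535353353555533355,
     426464646444444464444462, 533353335555353533533155, 335333313553533553533333,
     446442442444244664444642, 333753535535553333333353, 662624244444444444244644,
     444266624244464444444244, 531355533553353333553535, 444244644224444464264644]
  | c4C =>
    [262444646646444444446444, 533335333373353355535353, 333353535335353355535515,
     444462644642442244446444, 133335533353355555553533, 446444242464464442446424,
     535353353535353553553735, 335553353533575533553355, 535353553335575333553535,
     424244644464464242444644]
  | c5B =>
    [333335553555573535535335, 533355355553355553551535, 535553335133335535533553,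
     244466442264464444442444, 466444444624422244446444, 533555333355533553333155,
     424464444264264444644244, 444246644424426424446444]
  | c6E =>
    [553355575353355353353335, 535573335553535353553353, 444642424444466444244462,
     422244446444444244446664, 446422244444442424424644, 442244644462444244242444,
     533357355535335355533535, 333357335533353353353535]
  | c6G =>
    [244222244424444644464444, 442244424442444264444426, 422642244644444664444444,
     355735355355553353533533, 335357335553355335535535, 535351533335355535353335]
  | c7B =>
    [333553335333355533555551, 442466664444444244644446, 642444442644424224444424,
     553355573555333335355335, 442246466464424244444444, 466442244444446444242464]
  | c8E =>
    [333353355335333333553755, 355355531355353555355355, 242442444424466444464464,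
     244424644464424424444224, 242644644444444424466424, 553533533533335555533575]
  | c10F =>
    [735535335355533535335355, 353553335155533535333553, 353553355535555353337533,
     424446264242444444444466]

/-- The vectors `imageVec`, in the encoding of `digit`. -/
def ClassName.imageRows : ClassName → List ℕ
  | c1A =>
    -- For the identity the level is `1` and the isometry is the identity of `Λ* = Λ`, so images and
    -- dual basis coincide.
    c1A.dualRows
  | c2A =>
    [315355353355333355355533, 464624442444642444244464, 573353555533535335553353,
     426444442644442464244644, 444644426422446424644444, 555353535533335335753535,
     355553335355355533533537, 442424424244444442224244, 555553533333333333533537,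
     664444622444442444244446, 553733533533533353533353, 426644444444444466464642,
     464264424244444424644446, 444444464622444426464442, 224644264244444446464444,
     515553553555333355553535]
  | c2C =>
    [444444446422246442424424, 446224462644242462242444, 642444442446442424464446,
     444444442426242442464424, 444444446422646446424424, 444444446426246442464424,
     424444444424644246646424, 444444262646442444464244, 644442464626424444262426,
     444222444424224442444424, 224446244422464244424222, 646222444444424464444446]
  | c3B =>
    [355355553135535533535555, 422424224644246444444444, 533553351155557555353535,
     133355355333535533533555, 333533331355333533353535, 355533533155353355355333,
     644444444442464266444242, 244424424244224422444444, 733533333553355555355535,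
     444466464244644444642464, 444642442464444444266424, 733355355335555355533353]
  | c4C =>
    [553553533755553533533353, 244244264444424264244444, 333533335133335335553335,
     553553535733355535553333, 224424244244424244444442, 464464466444446466464444,
     444644446644446446664446, 624424644644464644444446, 535335535355555535355557,
     355355335555535375355555]
  | c5B =>
    [353533555335553353573355, 535355531553353555535553, 535355333553331535355533,
     464644464446646444464446, 244424446246444242424444, 442442446426442444442244,
     444444440444444444484444, 555555353551533535335535]
  | c6E =>
    [644464466446642444442444, 555355555735533333533353, 422442244444446444246424,
     733333335535355355335333, 244424422442242444442444, 444444442242422422442444,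
     444244446426444244424242, 244424424244224422444444]
  | c6G =>
    [444444444444440444448444, 444444448444440444444444, 444444448444444444448444,
     444424426444226222442242, 444464466444622622446646, 444464466444662266446242]
  | c7B =>
    [553553535533551553355535, 335335353351333335533353, 553553535533555553315535,
     424444444444224244422242, 535555555551335355533353, 555555555555551555555555]
  | c8E =>
    [335335353555533353335551, 335335353155533353335555, 464664424644444424644446,
     333333333733333333333333, 444444404444444404444444, 464664424244444424644442]
  | c10F =>
    [444444444448444444484444, 444444440444440444444444, 446446644466464464666664,
     224224426244246242444442]

/-- The rows of the matrix `coeff`, in the encoding of `digit`. -/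
def ClassName.coeffRows : ClassName → List ℕ
  | c1A =>
    [554225243655452534644368, 555234424644363533653486, 443454336554446353443843,
     444435353343432643238334, 463255445462443353483454, 454343445656464344842466,
     635533542426555438433334, 352355455363624283454533, 546424332534443824336355,
     435662535435448345432632, 655442534536384425643465, 553344343455834465444434,
     545542443538565436623445, 362255256583533362564545, 545234224855454534643566,
     242464458463345252553643, 242545485254433354445324, 445652844224355345443342,
     332228254452422453355445, 354582546354446253453532, 335852654225346435324422,
     548542522525355625434354, 584353444464553453564455, 855333422535564536444455]
  | c2A =>
    [4364443455534354, 5445343354545454, 4454543554523343, 4444543543433343, 3543354444634344,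
     4434333433455454, 5365543455334443, 5445533453434442, 4444445444443445, 3443444534444444,
     4354544445344444, 5445534454344543, 5445544354444443, 5355544355344544, 3433444523443344,
     4545454354535433]
  | c2C =>
    [344445444454, 434354455344, 335354454444, 553443554543, 544253664543, 434344455444,
     334445444354, 444344554554, 454634324334, 444444433445, 444544334435, 444444454544]
  | c3B =>
    [443345344544, 553435455345, 445533645354, 334454333533, 433344343544, 443455344434,
     334334443554, 445443544443, 444464333533, 554445454345, 444445354434, 433454344523]
  | c4C =>
    [5444444434, 5353543535, 5444334544, 4443445444, 4444455333, 4435344333, 4354543444, 4445344444,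
     4443544434, 4544345454]
  | c5B =>
    [43445454, 44434444, 54443344, 55443344, 44444544, 45544443, 34444544, 34445543]
  | c6E =>
    [44444435, 43444554, 43445444, 45443544, 53445445, 35544443, 44445344, 44353545]
  | c6G =>
    [344454, 434445, 443444, 444453, 444543, 444443]
  | c7B =>
    [353345, 454434, 445434, 444334, 444454, 444433]
  | c8E =>
    [535453, 353444, 444343, 354444, 544444, 344544]
  | c10F =>
    [3444, 4344, 4434, 4443]

/-! ### Decoding the tables, and the integral model of the representatives. -/

/-- The entry `j` of a vector whose entries, increased by `4`, are the decimal digits of `row`, from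
the least significant one on. -/
def digit (row j : ℕ) : ℤ := ((row / 10 ^ j % 10 : ℕ) : ℤ) - 4

/-- A basis of the fixed-point lattice of `n.rep`, in the coordinates of `leechInt`. -/
def ClassName.basisVec (n : ClassName) (i : Fin n.rank) (a : Fin 24) : ℤ :=
  digit (n.basisRows.getD i 0) a

/-- The images of the dual basis of `basisVec` under a similarity onto the fixed-point lattice. -/
def ClassName.imageVec (n : ClassName) (i : Fin n.rank) (a : Fin 24) : ℤ :=
  digit (n.imageRows.getD i 0) a

/-- Vectors of `leechInt` that project to the dual basis of `basisVec`. -/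
def ClassName.dualVec (n : ClassName) (i : Fin n.rank) (a : Fin 24) : ℤ :=
  digit (n.dualRows.getD i 0) a

/-- The coefficients of `basisVec` in terms of `imageVec`. -/
def ClassName.coeff (n : ClassName) (i j : Fin n.rank) : ℤ :=
  digit (n.coeffRows.getD i 0) j

/-- The inverse of `n.perm`, read off from its table. -/
def ClassName.source (n : ClassName) (a : Fin 24) : Fin 24 :=
  Fin.ofNat 24 (n.sourceTable.getD a 0)

/-- The action of `n.rep` in the coordinates of `leechInt`. -/
def ClassName.act (n : ClassName) (x : Fin 24 → ℤ) (a : Fin 24) : ℤ :=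
  if n.source a ∈ n.signs then -x (n.source a) else x (n.source a)

/-- The sum over the cyclic group generated by `n.rep`, in the coordinates of `leechInt`. -/
def ClassName.trace (n : ClassName) (x : Fin 24 → ℤ) (a : Fin 24) : ℤ :=
  ∑ k ∈ Finset.range n.period, n.act^[k] x a

/-- A decidable sufficient condition for membership in `leechInt`. -/
def LeechTest (x : Fin 24 → ℤ) : Prop :=
  (∀ i, x i = x 0 + 2 * ((x i - x 0) / 2)) ∧
  (∀ j : Fin 12, (x (Fin.natAdd 12 j) - x 0) / 2 % 2 =
    (∑ i : Fin 12, (x (Fin.castAdd 12 i) - x 0) / 2 * ((golayB i j).val : ℤ)) % 2) ∧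
  (∑ i, x i - 4 * x 0) % 8 = 0

instance (x : Fin 24 → ℤ) : Decidable (LeechTest x) :=
  inferInstanceAs (Decidable (_ ∧ _ ∧ _))

/-! ### Coordinates -/

theorem scaledEmb_apply (x : Fin 24 → ℤ) (a : Fin 24) : scaledEmb x a = (x a : ℝ) / √8 := rfl

theorem eq_sum_scaledEmb (v : Space) :
    v = ∑ a, (√8 * v a) • scaledEmb (Pi.single a 1) := by
  ext i
  simp only [WithLp.ofLp_sum, WithLp.ofLp_smul, Finset.sum_apply, Pi.smul_apply, scaledEmb_apply,
    smul_eq_mul, Pi.single_apply]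
  rw [Finset.sum_eq_single i]
  · have h : (√8 : ℝ) ≠ 0 := by positivity
    simp only [if_true, Int.cast_one]
    field_simp
  · intro a _ ha
    simp [ha.symm]
  · simp

theorem linearMap_ext_scaledEmb {f g : Space →ₗ[ℝ] Space}
    (h : ∀ a, f (scaledEmb (Pi.single a 1)) = g (scaledEmb (Pi.single a 1))) : f = g := by
  refine LinearMap.ext fun v => ?_
  rw [eq_sum_scaledEmb v]
  simp only [map_sum, map_smul, h]

theorem Co0_ext {σ : Co0} (h : ∀ a, (σ : Space ≃ₗᵢ[ℝ] Space) (scaledEmb (Pi.single a 1)) =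
    scaledEmb (Pi.single a 1)) : σ = 1 := by
  have h1 := linearMap_ext_scaledEmb
    (f := (σ : Space ≃ₗᵢ[ℝ] Space).toLinearEquiv.toLinearMap) (g := LinearMap.id) h
  exact Subtype.ext (LinearIsometryEquiv.ext fun v => LinearMap.congr_fun h1 v)

/-- These vectors of `Λ` span `Space` over the reals, so an element of `Co0` that is trivial on `Λ`
is trivial. -/
theorem scaledEmb_single_mem (a : Fin 24) : scaledEmb (Pi.single a 8) ∈ leech := by
  refine ⟨_, ⟨0, Pi.single a 4, ?_, fun i => ?_, ?_⟩, rfl⟩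
  · convert golayCode.zero_mem using 1
    funext i
    by_cases hi : i = a
    · subst hi; simp only [Pi.single_eq_same]; rfl
    · simp [hi]
  · by_cases hi : i = a
    · subst hi; simp
    · simp [hi]
  · simp

/-! ### The action on the Leech lattice -/

/-- The action of an element of `Co_0` on the Leech lattice. -/
def leechMap (τ : Co0) : leech →ₗ[ℤ] leech :=
  ((τ : Space ≃ₗᵢ[ℝ] Space).toLinearEquiv.toLinearMap.restrictScalars ℤ).restrict
    fun v hv => (τ.2 v).2 hv

@[simp]
theorem coe_leechMap (τ : Co0) (x : leech) :
    (leechMap τ x : Space) = (τ : Space ≃ₗᵢ[ℝ] Space) x := rfl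

theorem leechMap_mul (σ τ : Co0) (x : leech) : leechMap (σ * τ) x = leechMap σ (leechMap τ x) :=
  rfl

theorem leechMap_one (x : leech) : leechMap 1 x = x := rfl

theorem leechMap_inv_leechMap (τ : Co0) (x : leech) : leechMap τ⁻¹ (leechMap τ x) = x := by
  rw [← leechMap_mul, inv_mul_cancel, leechMap_one]

theorem leechMap_leechMap_inv (τ : Co0) (x : leech) : leechMap τ (leechMap τ⁻¹ x) = x := by
  rw [← leechMap_mul, mul_inv_cancel, leechMap_one]

theorem coe_mem_fixedLattice {τ : Co0} {x : leech} :
    (x : Space) ∈ fixedLattice τ ↔ leechMap τ x = x :=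
  ⟨fun h => Subtype.ext h.2, fun h => ⟨x.2, congrArg Subtype.val h⟩⟩

theorem pairing_leechMap (τ : Co0) (x y : leech) :
    pairing (leechMap τ x) (leechMap τ y) = pairing x y := by
  simp only [pairing, coe_leechMap, LinearIsometryEquiv.inner_map_map]

theorem isStandardLift_iff {τ : Co0} {g : MulAut LeechHat} : IsStandardLift τ g ↔
    (∀ a, (g a).vec = leechMap τ a.vec) ∧
      ∀ α, leechMap τ α = α → g ⟨1, α⟩ = ⟨1, α⟩ := by
  simp only [IsStandardLift, coe_mem_fixedLattice, Subtype.ext_iff, coe_leechMap]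

/-! ### Existence of standard lifts -/

theorem cocycleExp_eq_sum_leechBasis (σ τ : Co0) (x y : leech) :
    cocycleExp (leechMap σ x) (leechMap τ y) = ∑ i, ∑ j,
      leechBasis.repr x i * leechBasis.repr y j *
        cocycleExp (leechMap σ (leechBasis i)) (leechMap τ (leechBasis j)) := by
  let B : leech →+ leech →+ ℤ := AddMonoidHom.mk'
    (fun x => AddMonoidHom.mk' (fun y => cocycleExp x y) (cocycleExp_add_right x))
    (fun x y => AddMonoidHom.ext (cocycleExp_add_left x y))
  have hB : ∀ x y, cocycleExp x y = B x y := fun _ _ => rfl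
  conv_lhs => rw [← leechBasis.sum_repr x, ← leechBasis.sum_repr y]
  simp only [map_sum, map_zsmul, hB, AddMonoidHom.finsetSum_apply, AddMonoidHom.coe_smul,
    Pi.smul_apply, smul_eq_mul, Finset.mul_sum]
  rw [Finset.sum_comm]
  exact Finset.sum_congr rfl fun i _ => Finset.sum_congr rfl fun j _ => by ring

theorem choose_two_add (a b : ℤ) :
    (a + b) * (a + b - 1) / 2 = a * (a - 1) / 2 + b * (b - 1) / 2 + a * b := by
  obtain ⟨s, hs⟩ := Int.even_mul_pred_self a
  obtain ⟨t, ht⟩ := Int.even_mul_pred_self b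
  have h : (a + b) * (a + b - 1) = 2 * (s + t + a * b) := by linear_combination hs + ht
  rw [h, hs, ht]
  omega

/-- A symmetric bilinear form modulo `2` is the polarization of a function modulo `2`. -/
theorem exists_polarization {M ι : Type*} [AddCommGroup M] [Fintype ι] [LinearOrder ι]
    (b : Module.Basis ι ℤ M) (D : ι → ι → ℤ) (hD : ∀ i j, (2 : ℤ) ∣ D i j - D j i) :
    ∃ h : M → ℤ, ∀ x y, (2 : ℤ) ∣ h (x + y) - h x - h y -
      ∑ i, ∑ j, b.repr x i * b.repr y j * D i j := by
  -- Off the diagonal, `x i * x j` for `j < i` polarizes to the symmetric cross terms. On the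
  -- diagonal a square would polarize to an even number, so the binomial coefficient `x i` choose
  -- `2` is used, whose polarization is `x i * y i`.
  refine ⟨fun x => ∑ i, ∑ j, if i = j then b.repr x i * (b.repr x i - 1) / 2 * D i j
    else if j < i then b.repr x i * b.repr x j * D i j else 0, fun x y => ?_⟩
  have h1 : ∑ i, ∑ j, (if i < j then b.repr x i * b.repr y j * D j i else 0) =
      ∑ i, ∑ j, (if j < i then b.repr x j * b.repr y i * D i j else 0) := Finset.sum_comm
  have h2 : (2 : ℤ) ∣ ∑ i, ∑ j, (if i < j then b.repr x i * b.repr y j * D j i else 0) -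
      ∑ i, ∑ j, (if i < j then b.repr x i * b.repr y j * D i j else 0) := by
    simp only [← Finset.sum_sub_distrib]
    refine Finset.dvd_sum fun i _ => Finset.dvd_sum fun j _ => ?_
    split_ifs
    · rw [← mul_sub]; exact (hD j i).mul_left _
    · simp
  rw [h1] at h2
  convert h2 using 1
  simp only [← Finset.sum_sub_distrib]
  refine Finset.sum_congr rfl fun i _ => Finset.sum_congr rfl fun j _ => ?_
  simp only [map_add, Finsupp.add_apply]
  rcases lt_trichotomy i j with h | rfl | h
  · simp [h.ne, h, h.not_gt]
  · simp only [if_true, lt_irrefl, if_false, choose_two_add]; ring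
  · simp only [h.ne', h, h.not_gt, if_true, if_false]; ring

/-- The fixed points of an endomorphism of a lattice are a direct summand. -/
theorem exists_projection_fixed {M : Type*} [AddCommGroup M] [Module.Free ℤ M] [Module.Finite ℤ M]
    (f : M →ₗ[ℤ] M) : ∃ p : M →ₗ[ℤ] M, (∀ x, f (p x) = p x) ∧ ∀ x, f x = x → p x = x := by
  -- The range of `f - 1` is a submodule of a free `ℤ`-module of finite rank, hence projective. A
  -- section `s` of `f - 1` over it yields the projection `1 - s ∘ (f - 1)` onto the kernel.
  obtain ⟨s, hs⟩ := Module.projective_lifting_property (f - LinearMap.id).rangeRestrict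
    LinearMap.id (f - LinearMap.id).surjective_rangeRestrict
  refine ⟨LinearMap.id - s ∘ₗ (f - LinearMap.id).rangeRestrict, fun x => ?_, fun x hx => ?_⟩
  · have h := congrArg Subtype.val
      (LinearMap.congr_fun hs ((f - LinearMap.id).rangeRestrict x))
    simp only [LinearMap.comp_apply, LinearMap.id_apply, LinearMap.codRestrict_apply,
      LinearMap.sub_apply, LinearMap.rangeRestrict] at h ⊢
    rw [map_sub, sub_eq_iff_eq_add] at *
    rw [h]
    abel
  · have h : (f - LinearMap.id).rangeRestrict x = 0 := Subtype.ext (sub_eq_zero.2 hx)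
    simp [h]

/-- The first property makes `e^α ↦ (-1)^(h α) e^(τ α)` multiplicative, the second makes it a
standard lift. -/
theorem exists_lift_exponent (τ : Co0) : ∃ h : leech → ℤ,
    (∀ x y, (2 : ℤ) ∣ h (x + y) - h x - h y -
      (cocycleExp x y - cocycleExp (leechMap τ x) (leechMap τ y))) ∧
    ∀ x, leechMap τ x = x → h x = 0 := by
  obtain ⟨h, hh⟩ := exists_polarization leechBasis
    -- Writing `leechMap 1` lets `cocycleExp_eq_sum_leechBasis` expand both bilinear forms.
    (fun i j => cocycleExp (leechMap 1 (leechBasis i)) (leechMap 1 (leechBasis j)) -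
      cocycleExp (leechMap τ (leechBasis i)) (leechMap τ (leechBasis j))) fun i j => by
        have h1 := cocycleExp_comm (leechBasis i) (leechBasis j)
        have h2 := cocycleExp_comm (leechMap τ (leechBasis i)) (leechMap τ (leechBasis j))
        rw [pairing_leechMap] at h2
        simp only [leechMap_one]
        omega
  have key : ∀ x y, (2 : ℤ) ∣ h (x + y) - h x - h y -
      (cocycleExp x y - cocycleExp (leechMap τ x) (leechMap τ y)) := fun x y => by
    have := hh x y
    simp only [mul_sub, Finset.sum_sub_distrib] at this
    rwa [← cocycleExp_eq_sum_leechBasis, ← cocycleExp_eq_sum_leechBasis] at this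
  obtain ⟨p, hp, hp'⟩ := exists_projection_fixed (leechMap τ)
  -- The two cocycles agree on the image of `p`, so `h ∘ p` is additive modulo `2` and subtracting
  -- it does not disturb the congruence.
  refine ⟨fun x => h x - h (p x), fun x y => ?_, fun x hx => ?_⟩
  swap
  · change h x - h (p x) = 0
    rw [hp' x hx, sub_self]
  have h1 := key x y
  have h2 := key (p x) (p y)
  rw [hp, hp] at h2
  simp only [map_add]
  omega

theorem neg_one_zpow_eq_of_dvd {m n : ℤ} (h : (2 : ℤ) ∣ m - n) : (-1 : ℤˣ) ^ m = (-1) ^ n := by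
  obtain ⟨k, hk⟩ := h
  rw [show m = n + 2 * k by omega, zpow_add, zpow_mul, show ((-1 : ℤˣ) ^ (2 : ℤ)) = 1 by decide,
    one_zpow, mul_one]

theorem exists_isStandardLift (τ : Co0) : ∃ g : MulAut LeechHat, IsStandardLift τ g := by
  obtain ⟨h, hh, h0⟩ := exists_lift_exponent τ
  let g : MulAut LeechHat :=
    { toFun := fun a => ⟨a.sign * (-1) ^ h a.vec, leechMap τ a.vec⟩
      invFun := fun a => ⟨a.sign * ((-1) ^ h (leechMap τ⁻¹ a.vec))⁻¹, leechMap τ⁻¹ a.vec⟩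
      left_inv := fun a => by simp [leechMap_inv_leechMap, mul_assoc]
      right_inv := fun a => by simp [leechMap_leechMap_inv, mul_assoc]
      map_mul' := fun a b => by
        have key : (-1 : ℤˣ) ^ (cocycleExp a.vec b.vec + h (a.vec + b.vec)) =
            (-1) ^ (h a.vec + h b.vec +
              cocycleExp (leechMap τ a.vec) (leechMap τ b.vec)) :=
          neg_one_zpow_eq_of_dvd (by have := hh a.vec b.vec; omega)
        simp only [zpow_add] at key
        simp only [LeechHat.mul_def, map_add, cocycle]
        congr 1
        calc _ = a.sign * b.sign *
              ((-1) ^ cocycleExp a.vec b.vec * (-1) ^ h (a.vec + b.vec)) := by ac_rfl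
          _ = _ := by rw [key]; ac_rfl }
  refine ⟨g, isStandardLift_iff.2 ⟨fun a => rfl, fun α hα => ?_⟩⟩
  change (⟨1 * (-1) ^ h α, leechMap τ α⟩ : LeechHat) = _
  rw [h0 α hα, hα, zpow_zero, mul_one]

/-! ### The order of a standard lift -/

theorem LeechHat.mk_zero_mul (s t : ℤˣ) (α : leech) :
    (⟨s, 0⟩ * ⟨t, α⟩ : LeechHat) = ⟨s * t, α⟩ := by
  simp [LeechHat.mul_def, cocycle_zero_left]

theorem LeechHat.mk_zero_comm (s : ℤˣ) (a : LeechHat) : ⟨s, 0⟩ * a = a * ⟨s, 0⟩ := by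
  simp [LeechHat.mul_def, cocycle_zero_left, cocycle_zero_right, mul_comm]

theorem LeechHat.vec_mul (a b : LeechHat) : (a * b).vec = a.vec + b.vec := rfl

theorem LeechHat.mk_zero_eq_one_iff {s : ℤˣ} : (⟨s, 0⟩ : LeechHat) = 1 ↔ s = 1 := by
  simp [LeechHat.one_def]

section StandardLift

variable {τ : Co0} {g : MulAut LeechHat}

theorem IsStandardLift.vec_apply (hg : IsStandardLift τ g) (a : LeechHat) :
    (g a).vec = leechMap τ a.vec := (isStandardLift_iff.1 hg).1 a

/-- An automorphism that induces a linear map on `Λ` preserves the two elements above `0`, and it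
fixes the neutral one. -/
theorem IsStandardLift.apply_sign (hg : IsStandardLift τ g) (s : ℤˣ) : g ⟨s, 0⟩ = ⟨s, 0⟩ := by
  have h1 : g (1 : LeechHat) = 1 := map_one g
  rcases Int.units_eq_one_or s with rfl | rfl
  · exact h1
  · have h2 : (g ⟨-1, 0⟩).vec = 0 := by rw [hg.vec_apply, map_zero]
    have h3 : g ⟨-1, 0⟩ ≠ 1 := by
      rw [← h1, g.injective.ne_iff, Ne, LeechHat.mk_zero_eq_one_iff]
      decide
    rcases Int.units_eq_one_or (g ⟨-1, 0⟩).sign with h | h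
    · exact absurd (LeechHat.ext h h2) h3
    · exact LeechHat.ext h h2

theorem IsStandardLift.apply_eq_self (hg : IsStandardLift τ g) {a : LeechHat}
    (ha : leechMap τ a.vec = a.vec) : g a = a := by
  have h : a = ⟨a.sign, 0⟩ * ⟨1, a.vec⟩ := by rw [LeechHat.mk_zero_mul, mul_one]
  rw [h, map_mul, hg.apply_sign, (isStandardLift_iff.1 hg).2 _ ha]

theorem IsStandardLift.vec_pow_apply (hg : IsStandardLift τ g) (k : ℕ) (a : LeechHat) :
    ((g ^ k) a).vec = leechMap (τ ^ k) a.vec := by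
  induction k with
  | zero => rfl
  | succ k ih => rw [pow_succ', MulAut.mul_apply, hg.vec_apply, ih, pow_succ', leechMap_mul]

theorem leechMap_sum_pow {τ : Co0} {n : ℕ} (hn : τ ^ n = 1) (α : leech) :
    leechMap τ (∑ k ∈ Finset.range n, leechMap (τ ^ k) α) =
      ∑ k ∈ Finset.range n, leechMap (τ ^ k) α := by
  rw [map_sum]
  simp only [← leechMap_mul, ← pow_succ']
  have h := Finset.sum_range_succ' (fun k => leechMap (τ ^ k) α) n
  rw [Finset.sum_range_succ, hn, pow_zero] at h
  exact (add_right_cancel h).symm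

/-- The power of a standard lift that induces the identity on `Λ`. -/
theorem IsStandardLift.pow_apply (hg : IsStandardLift τ g) {n : ℕ} (hn : τ ^ n = 1)
    (a : LeechHat) : (g ^ n) a =
      ⟨(-1) ^ pairing a.vec (∑ k ∈ Finset.range n, leechMap (τ ^ k) a.vec), 0⟩ * a := by
  -- The element `r` is the product `a * g a * ⋯ * g^(n-1) a`. Multiplying it by `g^n a` on the
  -- right gives the same as applying `g` to it and multiplying by `a` on the left.
  have step : ∀ n : ℕ, ∃ r : LeechHat,
      r.vec = ∑ k ∈ Finset.range n, leechMap (τ ^ k) a.vec ∧ r * (g ^ n) a = a * g r := by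
    intro n
    induction n with
    | zero => exact ⟨1, by simp [LeechHat.one_def], by simp⟩
    | succ n ih =>
      obtain ⟨r, hr, h⟩ := ih
      refine ⟨r * (g ^ n) a, ?_, ?_⟩
      · rw [LeechHat.vec_mul, hr, hg.vec_pow_apply, Finset.sum_range_succ]
      · rw [map_mul, ← mul_assoc a, ← h, pow_succ', MulAut.mul_apply]
  obtain ⟨r, hr, h⟩ := step n
  -- When `τ ^ n = 1`, `r` lies above a fixed vector, so `g r = r` and the identity becomes `r * g^n
  -- a = a * r`; the commutator of `a` and `r` is the sign.
  rw [hg.apply_eq_self (by rw [hr, leechMap_sum_pow hn]), LeechHat.commutator a r, ← mul_assoc,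
    LeechHat.mk_zero_comm, mul_assoc] at h
  rw [mul_left_cancel h, hr]

theorem IsStandardLift.pow_eq_one (hg : IsStandardLift τ g) {n : ℕ} (h : g ^ n = 1) :
    τ ^ n = 1 := by
  refine Co0_ext fun a => ?_
  have h1 := congrArg Subtype.val (hg.vec_pow_apply n ⟨1, ⟨_, scaledEmb_single_mem a⟩⟩)
  rw [h] at h1
  change scaledEmb (Pi.single a 8) =
    ((τ ^ n : Co0) : Space ≃ₗᵢ[ℝ] Space) (scaledEmb (Pi.single a 8)) at h1
  rw [show (Pi.single a 8 : Fin 24 → ℤ) = (8 : ℤ) • Pi.single a 1 by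
    rw [← Pi.single_smul]; rfl, map_zsmul, map_zsmul, ← Int.cast_smul_eq_zsmul ℝ, ← Int.cast_smul_eq_zsmul ℝ] at h1
  exact (smul_right_injective Space (by norm_num : ((8 : ℤ) : ℝ) ≠ 0) h1).symm

/-- The sign character by which the power of a standard lift that induces the identity acts is
trivial if and only if this pairing is even. -/
theorem IsStandardLift.pow_orderOf_eq_one_iff (hg : IsStandardLift τ g) :
    g ^ orderOf τ = 1 ↔
      ∀ α, 2 ∣ pairing α (∑ k ∈ Finset.range (orderOf τ), leechMap (τ ^ k) α) := by
  have h := fun a => hg.pow_apply (pow_orderOf_eq_one τ) a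
  constructor
  · intro h1 α
    have h2 := h ⟨1, α⟩
    rw [h1, LeechHat.mk_zero_mul, mul_one] at h2
    have h3 := congrArg LeechHat.sign h2
    by_contra h4
    rw [← even_iff_two_dvd, Int.not_even_iff_odd] at h4
    change (1 : ℤˣ) = (-1) ^ _ at h3
    rw [h4.neg_one_zpow] at h3
    exact absurd h3 (by decide)
  · intro h1
    refine MulEquiv.ext fun a => ?_
    rw [h a, (even_iff_two_dvd.2 (h1 a.vec)).neg_one_zpow]
    exact one_mul a

theorem IsStandardLift.pow_two_mul_orderOf (hg : IsStandardLift τ g) :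
    g ^ (2 * orderOf τ) = 1 := by
  refine MulEquiv.ext fun a => ?_
  have h := fun a => hg.pow_apply (pow_orderOf_eq_one τ) a
  rw [two_mul, pow_add, MulAut.mul_apply, h a, h, ← mul_assoc]
  simp only [LeechHat.vec_mul, zero_add, LeechHat.mk_zero_mul, Int.units_mul_self]
  exact one_mul a

theorem IsStandardLift.orderOf_eq (hg : IsStandardLift τ g)
    (h : ∀ α, 2 ∣ pairing α (∑ k ∈ Finset.range (orderOf τ), leechMap (τ ^ k) α)) :
    orderOf g = orderOf τ :=
  Nat.dvd_antisymm (orderOf_dvd_of_pow_eq_one (hg.pow_orderOf_eq_one_iff.2 h))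
    (orderOf_dvd_of_pow_eq_one (hg.pow_eq_one (pow_orderOf_eq_one g)))

theorem IsStandardLift.orderOf_eq_two_mul (hg : IsStandardLift τ g) {α : leech}
    (h : ¬ 2 ∣ pairing α (∑ k ∈ Finset.range (orderOf τ), leechMap (τ ^ k) α)) :
    orderOf g = 2 * orderOf τ := by
  obtain ⟨m, hm⟩ := orderOf_dvd_of_pow_eq_one (hg.pow_eq_one (pow_orderOf_eq_one g))
  have h1 : orderOf g ∣ 2 * orderOf τ := orderOf_dvd_of_pow_eq_one hg.pow_two_mul_orderOf
  have h2 : m ≠ 1 := by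
    rintro rfl
    refine h (hg.pow_orderOf_eq_one_iff.1 ?_ α)
    rw [← mul_one (orderOf τ), ← hm, pow_orderOf_eq_one]
  -- The value `0` of `orderOf` stands for infinite order; then both sides are `0`.
  rcases Nat.eq_zero_or_pos (orderOf τ) with h0 | h0
  · rw [hm, h0]; simp
  · rw [hm, mul_comm 2, Nat.mul_dvd_mul_iff_left h0, Nat.dvd_prime Nat.prime_two] at h1
    rw [hm, h1.resolve_left h2, mul_comm]

end StandardLift

/-! ### Conjugation in `Co_0` -/

theorem apply_inv_apply (σ : Co0) (v : Space) :
    (σ : Space ≃ₗᵢ[ℝ] Space) (((σ⁻¹ : Co0) : Space ≃ₗᵢ[ℝ] Space) v) = v :=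
  (σ : Space ≃ₗᵢ[ℝ] Space).apply_symm_apply v

theorem inv_apply_apply (σ : Co0) (v : Space) :
    ((σ⁻¹ : Co0) : Space ≃ₗᵢ[ℝ] Space) ((σ : Space ≃ₗᵢ[ℝ] Space) v) = v :=
  (σ : Space ≃ₗᵢ[ℝ] Space).symm_apply_apply v

theorem inner_apply_left (σ : Co0) (v w : Space) :
    ⟪(σ : Space ≃ₗᵢ[ℝ] Space) v, w⟫_ℝ =
      ⟪v, ((σ⁻¹ : Co0) : Space ≃ₗᵢ[ℝ] Space) w⟫_ℝ := by
  conv_lhs => rw [← apply_inv_apply σ w]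
  exact LinearIsometryEquiv.inner_map_map _ _ _

theorem coe_mul_apply (σ τ : Co0) (v : Space) : ((σ * τ : Co0) : Space ≃ₗᵢ[ℝ] Space) v =
    (σ : Space ≃ₗᵢ[ℝ] Space) ((τ : Space ≃ₗᵢ[ℝ] Space) v) := rfl

theorem conj_apply_of_fixed {τ : Co0} (σ : Co0) {v : Space}
    (hv : (τ : Space ≃ₗᵢ[ℝ] Space) v = v) :
    ((σ * τ * σ⁻¹ : Co0) : Space ≃ₗᵢ[ℝ] Space) ((σ : Space ≃ₗᵢ[ℝ] Space) v) =
      (σ : Space ≃ₗᵢ[ℝ] Space) v := by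
  rw [coe_mul_apply, coe_mul_apply, inv_apply_apply, hv]

theorem inv_apply_fixed {τ : Co0} (σ : Co0) {v : Space}
    (hv : ((σ * τ * σ⁻¹ : Co0) : Space ≃ₗᵢ[ℝ] Space) v = v) :
    (τ : Space ≃ₗᵢ[ℝ] Space) (((σ⁻¹ : Co0) : Space ≃ₗᵢ[ℝ] Space) v) =
      ((σ⁻¹ : Co0) : Space ≃ₗᵢ[ℝ] Space) v := by
  conv_rhs => rw [← hv, coe_mul_apply, coe_mul_apply, inv_apply_apply]

theorem apply_mem_fixedLattice_conj {τ : Co0} (σ : Co0) {v : Space} (hv : v ∈ fixedLattice τ) :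
    (σ : Space ≃ₗᵢ[ℝ] Space) v ∈ fixedLattice (σ * τ * σ⁻¹) :=
  ⟨(σ.2 v).2 hv.1, conj_apply_of_fixed σ hv.2⟩

theorem inv_apply_mem_fixedLattice {τ : Co0} (σ : Co0) {v : Space}
    (hv : v ∈ fixedLattice (σ * τ * σ⁻¹)) :
    ((σ⁻¹ : Co0) : Space ≃ₗᵢ[ℝ] Space) v ∈ fixedLattice τ :=
  ⟨(σ⁻¹.2 v).2 hv.1, inv_apply_fixed σ hv.2⟩

/-! ### Similarities from the dual lattice -/

/-- A similarity of norm `ℓ` from the dual of `Λ^τ` onto `Λ^τ`, given by its values `c` at the basis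
`d` of `(Λ^τ)*` that is dual to the basis `b` of `Λ^τ`. -/
structure SimilarityData (τ : Co0) (ℓ : ℕ) where
  /-- the rank of `Λ^τ` -/
  r : ℕ
  /-- a basis of `Λ^τ` -/
  b : Fin r → Space
  /-- the dual basis -/
  d : Fin r → Space
  /-- the images of the dual basis -/
  c : Fin r → Space
  b_mem : ∀ i, b i ∈ fixedLattice τ
  c_mem : ∀ i, c i ∈ fixedLattice τ
  d_fixed : ∀ i, (τ : Space ≃ₗᵢ[ℝ] Space) (d i) = d i
  d_int : ∀ i, ∀ w ∈ fixedLattice τ, ∃ n : ℤ, ⟪d i, w⟫_ℝ = n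
  expand : ∀ v, (τ : Space ≃ₗᵢ[ℝ] Space) v = v → v = ∑ i, ⟪d i, v⟫_ℝ • b i
  dual : ∀ i j, ⟪b i, d j⟫_ℝ = if i = j then 1 else 0
  b_mem_span : ∀ i, b i ∈ Submodule.span ℤ (Set.range c)
  inner_c : ∀ i j, ⟪c i, c j⟫_ℝ = ℓ * ⟪d i, d j⟫_ℝ

namespace SimilarityData

variable {τ : Co0} {ℓ : ℕ} (S : SimilarityData τ ℓ)

/-- The difference of the two sides is fixed by `τ` and orthogonal to every `b i`; by `expand` it is
a combination of the `b i`, hence orthogonal to itself. -/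
theorem expand_dual {v : Space} (hv : (τ : Space ≃ₗᵢ[ℝ] Space) v = v) :
    v = ∑ i, ⟪S.b i, v⟫_ℝ • S.d i := by
  rw [← sub_eq_zero]
  set u := v - ∑ i, ⟪S.b i, v⟫_ℝ • S.d i with hu
  have hτ : (τ : Space ≃ₗᵢ[ℝ] Space) u = u := by
    simp only [hu, map_sub, map_sum, map_smul, hv, S.d_fixed]
  have hb : ∀ j, ⟪u, S.b j⟫_ℝ = 0 := fun j => by
    rw [real_inner_comm, hu, inner_sub_right, inner_sum]
    simp [inner_smul_right, S.dual]
  have h : ⟪u, u⟫_ℝ = 0 := by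
    nth_rw 2 [S.expand u hτ]
    rw [inner_sum]
    exact Finset.sum_eq_zero fun j _ => by rw [inner_smul_right, hb, mul_zero]
  exact inner_self_eq_zero.1 h

theorem fixed_of_mem_span {τ : Co0} {v : Space}
    (hv : v ∈ Submodule.span ℝ (fixedLattice τ : Set Space)) :
    (τ : Space ≃ₗᵢ[ℝ] Space) v = v := by
  induction hv using Submodule.span_induction with
  | mem v h => exact h.2
  | zero => exact map_zero _
  | add v w _ _ h1 h2 => rw [map_add, h1, h2]
  | smul r v _ h => rw [map_smul, h]

theorem d_mem (i : Fin S.r) : S.d i ∈ dualLattice (fixedLattice τ) := by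
  refine ⟨?_, S.d_int i⟩
  -- Expanding `d i` in the `b j` shows that it lies in the real span of `Λ^τ`.
  rw [S.expand _ (S.d_fixed i)]
  exact Submodule.sum_mem _ fun j _ =>
    Submodule.smul_mem _ _ (Submodule.subset_span (S.b_mem j))

/-- The coefficients of `x` with respect to the `b i` are its inner products with the `d i`, which
are integers. -/
theorem mem_span_c {x : Space} (hx : x ∈ fixedLattice τ) :
    x ∈ Submodule.span ℤ (Set.range S.c) := by
  rw [S.expand x hx.2]
  refine Submodule.sum_mem _ fun i _ => ?_
  obtain ⟨n, hn⟩ := S.d_int i x hx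
  rw [hn, Int.cast_smul_eq_zsmul]
  exact Submodule.smul_mem _ n (S.b_mem_span i)

/-- The similarity, scaled to an isometry. -/
def toLinearMap : Space →ₗ[ℝ] Space :=
  ∑ i, ((√(ℓ : ℝ))⁻¹ • (innerₗ Space (S.b i))).smulRight (S.c i)

theorem toLinearMap_apply (y : Space) :
    S.toLinearMap y = ∑ i, ((√(ℓ : ℝ))⁻¹ * ⟪S.b i, y⟫_ℝ) • S.c i := by
  simp [toLinearMap, LinearMap.sum_apply]

theorem toLinearMap_smul (hℓ : 0 < ℓ) (z : Space) :
    S.toLinearMap (√(ℓ : ℝ) • z) = ∑ i, ⟪S.b i, z⟫_ℝ • S.c i := by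
  have h : √(ℓ : ℝ) ≠ 0 := (Real.sqrt_pos.2 (by exact_mod_cast hℓ)).ne'
  simp only [toLinearMap_apply, inner_smul_right, inv_mul_cancel_left₀ h]

theorem toLinearMap_d (hℓ : 0 < ℓ) (i : Fin S.r) :
    S.toLinearMap (√(ℓ : ℝ) • S.d i) = S.c i := by
  simp [S.toLinearMap_smul hℓ, S.dual]

theorem inner_toLinearMap (hℓ : 0 < ℓ) {y z : Space} (hy : (τ : Space ≃ₗᵢ[ℝ] Space) y = y)
    (hz : (τ : Space ≃ₗᵢ[ℝ] Space) z = z) :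
    ⟪S.toLinearMap y, S.toLinearMap z⟫_ℝ = ⟪y, z⟫_ℝ := by
  have h : (√(ℓ : ℝ))⁻¹ * (√(ℓ : ℝ))⁻¹ * ℓ = 1 := by
    rw [← mul_inv, Real.mul_self_sqrt (Nat.cast_nonneg ℓ),
      inv_mul_cancel₀ (by exact_mod_cast hℓ.ne')]
  conv_rhs => rw [S.expand_dual hy, S.expand_dual hz]
  simp only [toLinearMap_apply, sum_inner, inner_sum, real_inner_smul_left,
    real_inner_smul_right, S.inner_c]
  refine Finset.sum_congr rfl fun i _ => Finset.sum_congr rfl fun j _ => ?_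
  linear_combination ⟪S.b j, y⟫_ℝ * ⟪S.b i, z⟫_ℝ * ⟪S.d j, S.d i⟫_ℝ * h

theorem toLinearMap_mem (hℓ : 0 < ℓ) {y : Space}
    (hy : y ∈ √(ℓ : ℝ) • dualLattice (fixedLattice τ)) : S.toLinearMap y ∈ fixedLattice τ := by
  obtain ⟨z, hz, rfl⟩ := (Submodule.mem_smul_pointwise_iff_exists _ _ _).1 hy
  rw [S.toLinearMap_smul hℓ]
  refine Submodule.sum_mem _ fun i _ => ?_
  obtain ⟨n, hn⟩ := hz.2 _ (S.b_mem i)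
  rw [real_inner_comm, hn, Int.cast_smul_eq_zsmul]
  exact Submodule.smul_mem _ n (S.c_mem i)

theorem fixed_of_mem_smul {τ : Co0} {a : ℝ} {y : Space}
    (hy : y ∈ a • dualLattice (fixedLattice τ)) : (τ : Space ≃ₗᵢ[ℝ] Space) y = y := by
  obtain ⟨z, hz, rfl⟩ := (Submodule.mem_smul_pointwise_iff_exists _ _ _).1 hy
  rw [map_smul, fixed_of_mem_span hz.1]

theorem exists_isometry {τ : Co0} {ℓ : ℕ} (S : SimilarityData τ ℓ) (hℓ : 0 < ℓ) :
    ∃ φ : (√(ℓ : ℝ) • dualLattice (fixedLattice τ) : Submodule ℤ Space) ≃ₗ[ℤ] fixedLattice τ,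
      ∀ x y, ⟪(φ x : Space), (φ y : Space)⟫_ℝ = ⟪(x : Space), (y : Space)⟫_ℝ := by
  have hmem : ∀ y ∈ √(ℓ : ℝ) • dualLattice (fixedLattice τ),
      S.toLinearMap.restrictScalars ℤ y ∈ fixedLattice τ := fun y hy => S.toLinearMap_mem hℓ hy
  let f := (S.toLinearMap.restrictScalars ℤ).restrict hmem
  have hf : ∀ x y, ⟪(f x : Space), (f y : Space)⟫_ℝ = ⟪(x : Space), (y : Space)⟫_ℝ := fun x y =>
    S.inner_toLinearMap hℓ (fixed_of_mem_smul x.2) (fixed_of_mem_smul y.2)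
  have hinj : Function.Injective f := by
    refine (injective_iff_map_eq_zero f).2 fun x hx => Subtype.ext ?_
    have h := hf x x
    rw [hx, Submodule.coe_zero, inner_zero_left, eq_comm] at h
    exact inner_self_eq_zero.1 h
  -- Each `c i` is the image of `√ℓ • d i`; since the `c i` generate `Λ^τ`, this gives surjectivity.
  have hle : Submodule.span ℤ (Set.range S.c) ≤
      (√(ℓ : ℝ) • dualLattice (fixedLattice τ)).map (S.toLinearMap.restrictScalars ℤ) := by
    rw [Submodule.span_le]
    rintro _ ⟨i, rfl⟩
    exact ⟨√(ℓ : ℝ) • S.d i, Submodule.smul_mem_pointwise_smul _ _ _ (S.d_mem i),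
      S.toLinearMap_d hℓ i⟩
  have hsurj : Function.Surjective f := by
    rintro ⟨x, hx⟩
    obtain ⟨y, hy, h⟩ := hle (S.mem_span_c hx)
    exact ⟨⟨y, hy⟩, Subtype.ext h⟩
  exact ⟨LinearEquiv.ofBijective f ⟨hinj, hsurj⟩, hf⟩

/-- Transport along conjugation. -/
def conj (σ : Co0) : SimilarityData (σ * τ * σ⁻¹) ℓ where
  r := S.r
  b i := (σ : Space ≃ₗᵢ[ℝ] Space) (S.b i)
  d i := (σ : Space ≃ₗᵢ[ℝ] Space) (S.d i)
  c i := (σ : Space ≃ₗᵢ[ℝ] Space) (S.c i)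
  b_mem i := apply_mem_fixedLattice_conj σ (S.b_mem i)
  c_mem i := apply_mem_fixedLattice_conj σ (S.c_mem i)
  d_fixed i := conj_apply_of_fixed σ (S.d_fixed i)
  d_int i w hw := by
    obtain ⟨n, hn⟩ := S.d_int i _ (inv_apply_mem_fixedLattice σ hw)
    exact ⟨n, by rw [← hn, inner_apply_left]⟩
  expand v hv := by
    have h := S.expand _ (inv_apply_fixed σ hv)
    have h1 := congrArg (σ : Space ≃ₗᵢ[ℝ] Space) h
    rw [apply_inv_apply, map_sum] at h1
    simpa only [map_smul, inner_apply_left] using h1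
  dual i j := by rw [LinearIsometryEquiv.inner_map_map, S.dual]
  b_mem_span i := by
    have h := Submodule.mem_map_of_mem
      (f := (σ : Space ≃ₗᵢ[ℝ] Space).toLinearEquiv.toLinearMap.restrictScalars ℤ)
      (S.b_mem_span i)
    rw [Submodule.map_span, ← Set.range_comp] at h
    exact h
  inner_c i j := by simp only [LinearIsometryEquiv.inner_map_map, S.inner_c]

end SimilarityData

/-! ### Verification of the tables -/

namespace ClassName

/-- From here on the computations look up `sourceTable` and need not evaluate products of cycles. -/
theorem perm_symm_apply (n : ClassName) : ∀ a, n.perm.symm a = n.source a := by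
  cases n <;> decide +kernel

theorem period_pos (n : ClassName) : 0 < n.period := by
  cases n <;> decide

theorem level_pos (n : ClassName) : 0 < n.level := by
  cases n <;> decide

theorem act_iterate_period_single (n : ClassName) :
    ∀ a' a, n.act^[n.period] (Pi.single a' 1) a = (Pi.single a' 1 : Fin 24 → ℤ) a := by
  cases n <;> decide +kernel

theorem act_iterate_single_ne (n : ClassName) : ∀ m < n.period, 0 < m →
    ∃ a' a, n.act^[m] (Pi.single a' 1) a ≠ (Pi.single a' 1 : Fin 24 → ℤ) a := by
  cases n <;> decide +kernel

theorem leechTest_dualVec (n : ClassName) : ∀ i, LeechTest (n.dualVec i) := by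
  cases n <;> decide +kernel

theorem leechTest_imageVec (n : ClassName) : ∀ i, LeechTest (n.imageVec i) := by
  cases n <;> decide +kernel

theorem act_imageVec (n : ClassName) : ∀ i a, n.act (n.imageVec i) a = n.imageVec i a := by
  cases n <;> decide +kernel

theorem basisVec_eq (n : ClassName) :
    ∀ i a, n.basisVec i a = ∑ j, n.coeff i j * n.imageVec j a := by
  cases n <;> decide +kernel

/-- The `8` is the factor between the dot product of integral coordinates and the inner product.
Projecting `dualVec` does not change its products with the fixed vectors `basisVec`. -/
theorem basisVec_dot_dualVec (n : ClassName) :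
    ∀ i j, ∑ a, n.basisVec i a * n.dualVec j a = if i = j then 8 else 0 := by
  cases n <;> decide +kernel

/-- In matrix form, the sum over the cyclic group is the sum of the rank-one operators `v ↦ ⟨T
(dualVec i), v⟩ • basisVec i`. This single identity certifies that the `basisVec` span the fixed
lattice. -/
theorem trace_single (n : ClassName) : ∀ a a', 8 * n.trace (Pi.single a' 1) a =
    ∑ i, n.basisVec i a * n.trace (n.dualVec i) a' := by
  cases n <;> decide +kernel

/-- As `d j` is fixed, `⟨d i, d j⟩` equals the product of `dualVec i` with `d j`, which is `1 /
n.period` times the trace of `dualVec j`. -/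
theorem imageVec_dot_imageVec (n : ClassName) : ∀ i j,
    n.period * ∑ a, n.imageVec i a * n.imageVec j a =
      n.level * ∑ a, n.dualVec i a * n.trace (n.dualVec j) a := by
  cases n <;> decide +kernel

/-- The vectors `c1A.imageVec` generate `Λ`, and divisibility of dot products by `16 = 2 * 8` is
evenness of inner products. The order doubles for `2C`, `6G` and `10F`. -/
theorem level_eq (n : ClassName) :
    (n.level = n.period ∧ ∀ i, 16 ∣ ∑ a, c1A.imageVec i a * n.trace (c1A.imageVec i) a) ∨
      (n.level = 2 * n.period ∧
        ∃ i, ¬ 16 ∣ ∑ a, c1A.imageVec i a * n.trace (c1A.imageVec i) a) := by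
  cases n <;> decide +kernel

end ClassName

/-! ### Sums over cyclic groups -/

/-- The sum of the first `n` powers of `τ`. -/
def cyclicSum (τ : Co0) (n : ℕ) : Space →ₗ[ℝ] Space :=
  ∑ k ∈ Finset.range n, ((τ ^ k : Co0) : Space ≃ₗᵢ[ℝ] Space).toLinearEquiv.toLinearMap

theorem cyclicSum_apply (τ : Co0) (n : ℕ) (v : Space) :
    cyclicSum τ n v = ∑ k ∈ Finset.range n, ((τ ^ k : Co0) : Space ≃ₗᵢ[ℝ] Space) v := by
  simp [cyclicSum, LinearMap.sum_apply]

section CyclicSum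

variable {τ : Co0} {n : ℕ}

theorem pow_apply_of_fixed {u : Space} (hu : (τ : Space ≃ₗᵢ[ℝ] Space) u = u) (k : ℕ) :
    ((τ ^ k : Co0) : Space ≃ₗᵢ[ℝ] Space) u = u := by
  induction k with
  | zero => rfl
  | succ k ih => rw [pow_succ, coe_mul_apply, hu, ih]

theorem cyclicSum_of_fixed {u : Space} (hu : (τ : Space ≃ₗᵢ[ℝ] Space) u = u) :
    cyclicSum τ n u = (n : ℝ) • u := by
  rw [cyclicSum_apply, Finset.sum_congr rfl fun k _ => pow_apply_of_fixed hu k]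
  simp [Nat.cast_smul_eq_nsmul]

theorem apply_cyclicSum (hn : τ ^ n = 1) (v : Space) :
    (τ : Space ≃ₗᵢ[ℝ] Space) (cyclicSum τ n v) = cyclicSum τ n v := by
  rw [cyclicSum_apply, map_sum]
  simp only [← coe_mul_apply, ← pow_succ']
  have h := Finset.sum_range_succ' (fun k => ((τ ^ k : Co0) : Space ≃ₗᵢ[ℝ] Space) v) n
  rw [Finset.sum_range_succ, hn, pow_zero] at h
  exact (add_right_cancel h).symm

theorem inner_cyclicSum {u : Space} (hu : (τ : Space ≃ₗᵢ[ℝ] Space) u = u) (v : Space) :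
    ⟪cyclicSum τ n v, u⟫_ℝ = n * ⟪v, u⟫_ℝ := by
  have h : ∀ k, ⟪((τ ^ k : Co0) : Space ≃ₗᵢ[ℝ] Space) v, u⟫_ℝ = ⟪v, u⟫_ℝ := fun k => by
    conv_lhs => rw [← pow_apply_of_fixed hu k]
    exact LinearIsometryEquiv.inner_map_map _ _ _
  rw [cyclicSum_apply, sum_inner, Finset.sum_congr rfl fun k _ => h k]
  simp

/-- Multiplied by `n`, both sides become the inner product of the cyclic sums of `v` and `w`. -/
theorem inner_cyclicSum_comm (hn : τ ^ n = 1) (h0 : 0 < n) (v w : Space) :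
    ⟪v, cyclicSum τ n w⟫_ℝ = ⟪w, cyclicSum τ n v⟫_ℝ := by
  have h1 := inner_cyclicSum (n := n) (apply_cyclicSum hn w) v
  have h2 := inner_cyclicSum (n := n) (apply_cyclicSum hn v) w
  rw [real_inner_comm, h2] at h1
  have h3 : (n : ℝ) ≠ 0 := by exact_mod_cast h0.ne'
  exact (mul_left_cancel₀ h3 h1).symm

/-- Averaging is the orthogonal projection to the fixed space, so averages of vectors of `Λ` pair
integrally with `Λ^τ`. -/
theorem inner_average (h0 : 0 < n) {u : Space} (hu : (τ : Space ≃ₗᵢ[ℝ] Space) u = u)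
    (v : Space) : ⟪(n : ℝ)⁻¹ • cyclicSum τ n v, u⟫_ℝ = ⟪v, u⟫_ℝ := by
  have h3 : (n : ℝ) ≠ 0 := by exact_mod_cast h0.ne'
  rw [real_inner_smul_left, inner_cyclicSum hu, inv_mul_cancel_left₀ h3]

theorem pairing_sum_cast (α : leech) :
    (pairing α (∑ k ∈ Finset.range n, leechMap (τ ^ k) α) : ℝ) =
      ⟪(α : Space), cyclicSum τ n α⟫_ℝ := by
  rw [pairing_cast, cyclicSum_apply, Submodule.coe_sum]
  rfl

theorem pairing_sum_conj (σ : Co0) (α : leech) :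
    pairing α (∑ k ∈ Finset.range n, leechMap ((σ * τ * σ⁻¹) ^ k) α) =
      pairing (leechMap σ⁻¹ α)
        (∑ k ∈ Finset.range n, leechMap (τ ^ k) (leechMap σ⁻¹ α)) := by
  conv_lhs => rw [← leechMap_leechMap_inv σ α]
  simp only [conj_pow, leechMap_mul, leechMap_inv_leechMap]
  rw [← map_sum, pairing_leechMap]

end CyclicSum

theorem LeechTest.mem {x : Fin 24 → ℤ} (hx : LeechTest x) : scaledEmb x ∈ leech := by
  obtain ⟨h1, h2, h3⟩ := hx
  -- The integer `m` in `leechInt` matters only modulo `2`, since the all-ones word is in the Golay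
  -- code; `x 0` serves as `m`.
  refine ⟨x, ⟨x 0, fun i => (x i - x 0) / 2, fun j => ?_, h1, Int.dvd_of_emod_eq_zero h3⟩, rfl⟩
  have h := (ZMod.intCast_eq_intCast_iff' _ _ 2).2 (h2 j)
  push_cast at h
  simpa only [ZMod.natCast_zmod_val] using h

namespace ClassName

variable (n : ClassName)

/-! ### The representatives in coordinates -/

theorem rep_scaledEmb (x : Fin 24 → ℤ) :
    (n.rep : Space ≃ₗᵢ[ℝ] Space) (scaledEmb x) = scaledEmb (n.act x) := by
  ext a
  change (if n.perm.symm a ∈ n.signs then -(scaledEmb x (n.perm.symm a))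
    else scaledEmb x (n.perm.symm a)) = _
  rw [perm_symm_apply, scaledEmb_apply, scaledEmb_apply, act]
  split_ifs
  · push_cast; ring
  · rfl

theorem rep_pow_scaledEmb (k : ℕ) (x : Fin 24 → ℤ) :
    ((n.rep ^ k : Co0) : Space ≃ₗᵢ[ℝ] Space) (scaledEmb x) = scaledEmb (n.act^[k] x) := by
  induction k with
  | zero => rfl
  | succ k ih =>
    rw [pow_succ', coe_mul_apply, ih, rep_scaledEmb, Function.iterate_succ_apply']

theorem cyclicSum_scaledEmb (x : Fin 24 → ℤ) :
    cyclicSum n.rep n.period (scaledEmb x) = scaledEmb (n.trace x) := by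
  simp only [cyclicSum_apply, rep_pow_scaledEmb, ← map_sum]
  congr 1
  funext a
  rw [Finset.sum_apply]
  rfl

theorem orderOf_rep : orderOf n.rep = n.period := by
  refine (orderOf_eq_iff n.period_pos).2 ⟨Co0_ext fun a => ?_, fun m hm h0 h => ?_⟩
  · rw [rep_pow_scaledEmb, funext (n.act_iterate_period_single a)]
  · obtain ⟨a, a', ha⟩ := n.act_iterate_single_ne m hm h0
    refine ha (congrFun (scaledEmb_injective ?_) a')
    rw [← rep_pow_scaledEmb, h]
    rfl

theorem rep_pow_period : n.rep ^ n.period = 1 := by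
  rw [← orderOf_rep, pow_orderOf_eq_one]

/-! ### The similarity for a representative. -/

theorem scaledEmb_imageVec_mem (i : Fin n.rank) :
    scaledEmb (n.imageVec i) ∈ fixedLattice n.rep :=
  ⟨(n.leechTest_imageVec i).mem, by rw [rep_scaledEmb, funext (n.act_imageVec i)]⟩

theorem scaledEmb_basisVec_mem_span (i : Fin n.rank) : scaledEmb (n.basisVec i) ∈
    Submodule.span ℤ (Set.range fun i => scaledEmb (n.imageVec i)) := by
  have h : n.basisVec i = ∑ j, n.coeff i j • n.imageVec j := by
    funext a
    simp [basisVec_eq, Finset.sum_apply]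
  rw [h, map_sum]
  refine Submodule.sum_mem _ fun j _ => ?_
  rw [map_smul]
  exact Submodule.smul_mem _ _ (Submodule.subset_span ⟨j, rfl⟩)

/-- As integral combinations of the `imageVec`, the `basisVec` need no membership test of their own.
-/
theorem scaledEmb_basisVec_mem (i : Fin n.rank) :
    scaledEmb (n.basisVec i) ∈ fixedLattice n.rep := by
  refine Submodule.span_le.2 ?_ (n.scaledEmb_basisVec_mem_span i)
  rintro _ ⟨j, rfl⟩
  exact n.scaledEmb_imageVec_mem j

/-- Both sides are linear over the reals in `v`, so it is enough to compare them on the coordinate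
vectors, where `trace_single` applies. -/
theorem cyclicSum_eq_sum (v : Space) : cyclicSum n.rep n.period v =
    ∑ i, ⟪cyclicSum n.rep n.period (scaledEmb (n.dualVec i)), v⟫_ℝ •
      scaledEmb (n.basisVec i) := by
  have h : cyclicSum n.rep n.period = ∑ i,
      (innerₗ Space (cyclicSum n.rep n.period (scaledEmb (n.dualVec i)))).smulRight
        (scaledEmb (n.basisVec i)) := by
    refine linearMap_ext_scaledEmb fun a' => ?_
    simp only [LinearMap.sum_apply, LinearMap.smulRight_apply, innerₗ_apply_apply,
      cyclicSum_scaledEmb, inner_scaledEmb]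
    ext a
    have h1 := congrArg (Int.cast : ℤ → ℝ) (n.trace_single a a')
    push_cast at h1
    simp only [WithLp.ofLp_sum, WithLp.ofLp_smul, Finset.sum_apply, Pi.smul_apply,
      scaledEmb_apply, smul_eq_mul, Pi.single_apply, mul_ite, mul_one, mul_zero,
      Finset.sum_ite_eq', Finset.mem_univ, if_true]
    rw [← mul_right_inj' (show (8 : ℝ) ≠ 0 by norm_num), ← mul_div_assoc, h1, Finset.sum_div,
      Finset.mul_sum]
    exact Finset.sum_congr rfl fun i _ => by ring
  conv_lhs => rw [h]
  simp [LinearMap.sum_apply]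

/-- The similarity from the dual of the fixed-point lattice of a representative. -/
def similarityData : SimilarityData n.rep n.level where
  r := n.rank
  b i := scaledEmb (n.basisVec i)
  d i := (n.period : ℝ)⁻¹ • cyclicSum n.rep n.period (scaledEmb (n.dualVec i))
  c i := scaledEmb (n.imageVec i)
  b_mem := n.scaledEmb_basisVec_mem
  c_mem := n.scaledEmb_imageVec_mem
  d_fixed i := by rw [map_smul, apply_cyclicSum n.rep_pow_period]
  d_int i w hw := by
    rw [inner_average n.period_pos hw.2]
    exact ⟨_, (pairing_cast ⟨_, (n.leechTest_dualVec i).mem⟩ ⟨w, hw.1⟩).symm⟩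
  expand v hv := by
    have h0 : (n.period : ℝ) ≠ 0 := by exact_mod_cast n.period_pos.ne'
    -- On a fixed vector the left side is `n.period • v`; dividing by `n.period` gives the
    -- expansion.
    have h := n.cyclicSum_eq_sum v
    rw [cyclicSum_of_fixed hv] at h
    have h1 := congrArg ((n.period : ℝ)⁻¹ • ·) h
    simp only [inv_smul_smul₀ h0, Finset.smul_sum, smul_smul] at h1
    simpa only [real_inner_smul_left] using h1
  dual i j := by
    have hb : (n.rep : Space ≃ₗᵢ[ℝ] Space) (scaledEmb (n.basisVec i)) =
        scaledEmb (n.basisVec i) := (n.scaledEmb_basisVec_mem i).2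
    rw [real_inner_comm, inner_average n.period_pos hb, real_inner_comm, inner_scaledEmb,
      basisVec_dot_dualVec]
    split_ifs <;> norm_num
  b_mem_span := n.scaledEmb_basisVec_mem_span
  inner_c i j := by
    have h0 : (n.period : ℝ) ≠ 0 := by exact_mod_cast n.period_pos.ne'
    rw [inner_average n.period_pos (by rw [map_smul, apply_cyclicSum n.rep_pow_period]),
      real_inner_smul_right, cyclicSum_scaledEmb, inner_scaledEmb, inner_scaledEmb]
    have h := congrArg (Int.cast : ℤ → ℝ) (n.imageVec_dot_imageVec i j)
    rw [Int.cast_mul, Int.cast_mul, Int.cast_natCast, Int.cast_natCast] at h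
    field_simp
    linear_combination h

/-! ### The order of the standard lifts for the eleven classes. -/

theorem leech_le_span :
    leech ≤ Submodule.span ℤ (Set.range fun i => scaledEmb (c1A.imageVec i)) := by
  intro v hv
  -- The representative of `1A` is the identity, so its fixed-point lattice is all of `Λ`.
  refine c1A.similarityData.mem_span_c ⟨hv, ?_⟩
  rw [orderOf_eq_one_iff.1 c1A.orderOf_rep]
  rfl

/-- By `inner_cyclicSum_comm` the two cross terms of `⟨v + w, T (v + w)⟩` are equal integers, so
evenness passes from generators to sums. -/
theorem even_inner_cyclicSum
    (h : ∀ i, 16 ∣ ∑ a, c1A.imageVec i a * n.trace (c1A.imageVec i) a) {v : Space}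
    (hv : v ∈ leech) : ∃ m : ℤ, ⟪v, cyclicSum n.rep n.period v⟫_ℝ = 2 * m := by
  have hle : Submodule.span ℤ (Set.range fun i => scaledEmb (c1A.imageVec i)) ≤ leech := by
    rw [Submodule.span_le]
    rintro _ ⟨i, rfl⟩
    exact (c1A.leechTest_imageVec i).mem
  replace hv := leech_le_span hv
  induction hv using Submodule.span_induction with
  | mem v hv =>
    obtain ⟨i, rfl⟩ := hv
    obtain ⟨m, hm⟩ := h i
    refine ⟨m, ?_⟩
    rw [cyclicSum_scaledEmb, inner_scaledEmb, hm]
    push_cast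
    ring
  | zero => exact ⟨0, by simp⟩
  | add v w hv hw h1 h2 =>
    obtain ⟨p, hp⟩ := h1
    obtain ⟨q, hq⟩ := h2
    obtain ⟨t, ht⟩ : ∃ t : ℤ, ⟪v, cyclicSum n.rep n.period w⟫_ℝ = t := by
      have hs := pairing_cast ⟨v, hle hv⟩
        (∑ k ∈ Finset.range n.period, leechMap (n.rep ^ k) ⟨w, hle hw⟩)
      rw [Submodule.coe_sum] at hs
      rw [cyclicSum_apply]
      exact ⟨_, hs.symm⟩
    refine ⟨p + q + t, ?_⟩
    rw [map_add, inner_add_left, inner_add_right, inner_add_right, hp, hq,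
      inner_cyclicSum_comm n.rep_pow_period n.period_pos w v, ht]
    push_cast
    ring
  | smul r v hv h1 =>
    obtain ⟨p, hp⟩ := h1
    refine ⟨r * r * p, ?_⟩
    rw [map_zsmul, ← Int.cast_smul_eq_zsmul ℝ, ← Int.cast_smul_eq_zsmul ℝ, real_inner_smul_left,
      real_inner_smul_right, hp]
    push_cast
    ring

theorem orderOf_standardLift (σ : Co0) {g : MulAut LeechHat}
    (hg : IsStandardLift (σ * n.rep * σ⁻¹) g) : orderOf g = n.level := by
  have ho : orderOf (σ * n.rep * σ⁻¹) = n.period := by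
    rw [← n.orderOf_rep, ← MulAut.conj_apply, MulEquiv.orderOf_eq]
  rcases n.level_eq with ⟨hl, h⟩ | ⟨hl, i, h⟩
  · rw [hl, ← ho]
    refine hg.orderOf_eq fun α => ?_
    rw [ho, pairing_sum_conj]
    obtain ⟨m, hm⟩ := n.even_inner_cyclicSum h (leechMap σ⁻¹ α).2
    rw [← pairing_sum_cast] at hm
    exact ⟨m, by exact_mod_cast hm⟩
  · rw [hl, ← ho]
    -- The generator of `Λ` with odd exponent for `n.rep` is carried over by `σ`.
    refine hg.orderOf_eq_two_mul
      (α := leechMap σ ⟨_, (c1A.leechTest_imageVec i).mem⟩) fun ⟨m, hm⟩ => h ⟨m, ?_⟩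
    rw [ho, pairing_sum_conj, leechMap_inv_leechMap] at hm
    have h1 := pairing_sum_cast (τ := n.rep) (n := n.period)
      ⟨_, (c1A.leechTest_imageVec i).mem⟩
    rw [hm, cyclicSum_scaledEmb, inner_scaledEmb, eq_div_iff (by norm_num)] at h1
    have h2 : 2 * m * 8 = ∑ a, c1A.imageVec i a * n.trace (c1A.imageVec i) a := by
      exact_mod_cast h1
    rw [← h2]
    ring

end ClassName

end LeechDuality

/-! ### Reduction of the theorem to the representatives. -/

theorem theorem4p2 (τ : LeechDuality.Co0) (hτ : τ ∈ LeechDuality.P0) :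
    (∃ g : MulAut LeechDuality.LeechHat, LeechDuality.IsStandardLift τ g) ∧
    ∀ g : MulAut LeechDuality.LeechHat, LeechDuality.IsStandardLift τ g →
      ∃ φ : (√(orderOf g : ℝ) • LeechDuality.dualLattice (LeechDuality.fixedLattice τ) :
          Submodule ℤ LeechDuality.Space) ≃ₗ[ℤ] LeechDuality.fixedLattice τ,
        ∀ x y, inner ℝ (φ x : LeechDuality.Space) (φ y : LeechDuality.Space) =
          inner ℝ (x : LeechDuality.Space) (y : LeechDuality.Space) := by
  refine ⟨LeechDuality.exists_isStandardLift τ, fun g hg => ?_⟩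
  obtain ⟨n, hn⟩ := hτ
  obtain ⟨σ, rfl⟩ := isConj_iff.1 hn
  rw [n.orderOf_standardLift σ hg]
  exact (n.similarityData.conj σ).exists_isometry n.level_pos
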